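/- For $\theta\in\mathbb{R}$ let $\mathbf{u}(\theta)=(\cos\theta,\sin\theta)$. A convex body is a bounded convex set $C\subset\mathbb{R}^2$ with non-empty interior, and $\widehat{\mathbf{1}}_C(\boldsymbol{\xi})=\int_C e^{-2\pi i\,\mathbf{x}\cdot\boldsymbol{\xi}}\,d\mathbf{x}$. For a set $I$ of angles, let $P_C(I)$ be the length (arc length along the boundary curve, that is, one-dimensional Hausdorff measure) of the set of those boundary points $\mathbf{x}\in\partial C$ for which there is $\theta\in I$ with $\mathbf{x}\cdot\mathbf{u}(\theta)=\inf_{\mathbf{a}\in C}\mathbf{a}\cdot\mathbf{u}(\theta)$. There is an absolute constant $c>0$ such that, for every convex body $C\subset\mathbb{R}^2$ and every closed interval of angles $I=[\alpha,\beta]$ with $\alpha\le\beta\le\alpha+2\pi$, the following holds. 1. If $P_C(I)+P_C(I+\pi)>0$, then $$\limsup_{\rho\to+\infty}\frac{\int_I\left|\widehat{\mathbf{1}}_C(\rho\,\mathbf{u}(\theta))\right|^2d\theta}{\rho^{-3}\left(P_C(I)+P_C(I+\pi)\right)}\le c .$$ 2. If $P_C(I)+P_C(I+\pi)=0$, then $$\lim_{\rho\to+\infty}\rho^{3}\int_I\left|\widehat{\mathbf{1}}_C(\rho\,\mathbf{u}(\theta))\right|^2d\theta=0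 .$$ -/

import Mathlib

open MeasureTheory Filter
open scoped FourierTransform RealInnerProductSpace

/-- A planar convex body: a bounded convex subset of the Euclidean plane with non-empty interior
(it need not be closed). -/
structure IsPlanarConvexBody (C : Set (EuclideanSpace ℝ (Fin 2))) : Prop where
  convex : Convex ℝ C
  bounded : Bornology.IsBounded C
  interior_nonempty : (interior C).Nonempty

/-- The unit vector `u(θ) = (cos θ, sin θ)`. -/
noncomputable def unitVec (θ : ℝ) : EuclideanSpace ℝ (Fin 2) :=
  !₂[Real.cos θ, Real.sin θ]

/-- The Fourier transform of the characteristic function of `C`, that is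
`ξ ↦ ∫ x in C, exp (-2πi x·ξ)`. -/
noncomputable def indicatorFourier (C : Set (EuclideanSpace ℝ (Fin 2))) :
    EuclideanSpace ℝ (Fin 2) → ℂ :=
  𝓕 (C.indicator fun _ => (1 : ℂ))

/-- The set of normals of `C` at a boundary point `x`: the angles `θ` at which
`inf_{a ∈ C} a·u(θ) = x·u(θ)`. It is the `2π`-periodic set of all real representatives of the
angles. (For `x` in the closure of a closed `C` the infimum is a minimum.) -/
def normalAngles (C : Set (EuclideanSpace ℝ (Fin 2))) (x : EuclideanSpace ℝ (Fin 2)) : Set ℝ :=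
  {θ | IsGLB ((fun a => ⟪a, unitVec θ⟫) '' C) ⟪x, unitVec θ⟫}

/-- The portion of perimeter of `C` with respect to a set `I` of angles: the length
(one-dimensional Hausdorff measure, which on the boundary curve of a convex body is the
arc length) of the set of the boundary points that have a normal in `I`. -/
noncomputable def perimeterPortion (C : Set (EuclideanSpace ℝ (Fin 2))) (I : Set ℝ) : ℝ :=
  (Measure.hausdorffMeasure 1 : Measure (EuclideanSpace ℝ (Fin 2))).real
    {x | x ∈ frontier C ∧ (normalAngles C x ∩ I).Nonempty}

/-- The spherical average `∫_I |1̂_C(ρ u(θ))|² dθ`. -/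
noncomputable def sphericalAverage (C : Set (EuclideanSpace ℝ (Fin 2))) (I : Set ℝ) (ρ : ℝ) : ℝ :=
  ∫ θ in I, ‖indicatorFourier C (ρ • unitVec θ)‖ ^ 2

/-- `f ≼ g` with the constant `c`: `limsup_{x → +∞} f x / g x ≤ c`. The upper limit is taken in
the extended reals, so that it is `+∞` if the quotient is unbounded. -/
def AsympLeWith (c : ℝ) (f g : ℝ → ℝ) : Prop :=
  limsup (fun x => ((f x / g x : ℝ) : EReal)) atTop ≤ (c : EReal)

open Set Metric
open scoped Topology Real ENNReal

/-!
Let `L(t)` be the length of the chord of the closed body `K` on the line `⟪x, u(θ)⟫ = t`. By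
Fubini, the transform of `K` at `ρ u(θ)` is the one-dimensional transform of `L` at `ρ`. Shifting
`L` by half a period `1 / (2ρ)` in both directions shows that it is controlled by the `L¹` norm of
a second difference of `L`. As `L` is concave on its support, this second difference can be
positive only near the two ends, and its integral vanishes, so that the transform is at most
`(W(θ) + W(θ + π)) / (2ρ)` in absolute value, where `W(θ)` is the width of the cap of `K` of depth
`1 / ρ` with inner normal `u(θ)`.

It remains to bound `∫ W²` by `O(1 / ρ)` times a length. Let `S(θ)` be the distance by which the cap
extends beyond the face on one side, so that `W` is at most the sum of the two values of `S`. The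
part of the boundary of the cap at offsets between `S / 4` and `S / 2` has length at least `S / 4`,
and, unless `S = O(1 / ρ)`, its normals are close to `θ`. Conversely, the angles `θ` for which a
given boundary point lies in this middle part satisfy `∫ S(θ) dθ = O(1 / ρ)`. Integrating over pairs
(angle, boundary point) in either order gives the bound with the length taken over a slightly
enlarged interval of angles, and this length tends to the one for the original interval as the
enlargement shrinks.
-/

theorem isClosed_setOf_exists_mem {X Y : Type*} [TopologicalSpace X] [TopologicalSpace Y]
    {K : Set X} (hK : IsCompact K) {F : Set (Y × X)} (hF : IsClosed F) :
    IsClosed {y | ∃ x ∈ K, (y, x) ∈ F} := by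
  have := isCompact_iff_compactSpace.mp hK
  convert isClosedMap_fst_of_compactSpace (X := Y) (Y := K) _
    (hF.preimage (continuous_id.prodMap continuous_subtype_val)) using 1
  ext y
  simp

section Caps

variable {E : Type*} [NormedAddCommGroup E] [InnerProductSpace ℝ E]

/-- The cap of `K` of depth `d` cut off in the direction `w`: the points of `K` at which the
functional `⟪·, w⟫` exceeds its minimum over `K` by at most `d`. The cap of depth `0` is the face
of `K` with inner normal `w`. -/
def cap (K : Set E) (w : E) (d : ℝ) : Set E := {x ∈ K | ∀ a ∈ K, ⟪x, w⟫ ≤ ⟪a, w⟫ + d}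

/-- The support function `v ↦ sup_{x ∈ A} ⟪x, v⟫` of a nonempty bounded set `A`. -/
noncomputable def supportFunction (A : Set E) (v : E) : ℝ := sSup ((fun x => ⟪x, v⟫) '' A)

/-- The length of the orthogonal projection of `A` on the line spanned by a unit vector `v`. -/
noncomputable def width (A : Set E) (v : E) : ℝ := supportFunction A v + supportFunction A (-v)

/-- The points of `K` that have an inner normal in the set `D`, that is, the union of the faces
of `K` in the directions of `D`. -/
def supportSet (K : Set E) (D : Set E) : Set E := {x | ∃ w ∈ D, x ∈ cap K w 0}

variable {K A : Set E} {v w x : E} {d : ℝ}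

theorem inner_le_of_mem_face (hx : x ∈ cap K w 0) {a : E} (ha : a ∈ K) : ⟪x, w⟫ ≤ ⟪a, w⟫ := by
  simpa using hx.2 a ha

theorem notMem_interior_of_mem_face (hw : w ≠ 0) (hx : x ∈ cap K w 0) :
    x ∉ interior K := by
  intro hint
  have hlim : Tendsto (fun t : ℝ => x - t • w) (𝓝[>] 0) (𝓝 x) :=
    tendsto_nhdsWithin_of_tendsto_nhds (Continuous.tendsto' (by fun_prop) 0 x (by simp))
  obtain ⟨t, htK, ht⟩ :=
    ((hlim.eventually_mem (mem_interior_iff_mem_nhds.mp hint)).and self_mem_nhdsWithin).exists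
  have hle := inner_le_of_mem_face hx htK
  rw [inner_sub_left, real_inner_smul_left] at hle
  exact (mul_pos ht (real_inner_self_pos.mpr hw)).not_ge (by linarith)

theorem cap_mono {d' : ℝ} (h : d ≤ d') : cap K w d ⊆ cap K w d' :=
  fun _ hx => ⟨hx.1, fun a ha => (hx.2 a ha).trans (by gcongr)⟩

theorem isClosed_setOf_mem_cap (hK : IsClosed K) (d : ℝ) :
    IsClosed {p : E × E | p.2 ∈ cap K p.1 d} := by
  have : {p : E × E | p.2 ∈ cap K p.1 d} =
      Prod.snd ⁻¹' K ∩ ⋂ a ∈ K, {p : E × E | ⟪p.2, p.1⟫ ≤ ⟪a, p.1⟫ + d} := by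
    ext p
    simp only [cap, mem_ofPred_eq, mem_inter_iff, mem_preimage, mem_iInter]
  rw [this]
  exact (hK.preimage continuous_snd).inter <|
    isClosed_biInter fun a _ => isClosed_le (by fun_prop) (by fun_prop)

theorem isCompact_cap (hK : IsCompact K) (w : E) (d : ℝ) : IsCompact (cap K w d) :=
  hK.of_isClosed_subset
    ((isClosed_setOf_mem_cap hK.isClosed d).preimage (Continuous.prodMk_right w)) fun _ hx => hx.1

theorem convex_cap (hK : Convex ℝ K) (w : E) (d : ℝ) : Convex ℝ (cap K w d) := by
  intro x hx y hy a b ha hb hab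
  refine ⟨hK hx.1 hy.1 ha hb hab, fun z hz => ?_⟩
  calc ⟪a • x + b • y, w⟫ = a * ⟪x, w⟫ + b * ⟪y, w⟫ := by
        rw [inner_add_left, real_inner_smul_left, real_inner_smul_left]
    _ ≤ a * (⟪z, w⟫ + d) + b * (⟪z, w⟫ + d) := by
        gcongr
        · exact hx.2 z hz
        · exact hy.2 z hz
    _ = ⟪z, w⟫ + d := by rw [← add_mul, hab, one_mul]

theorem cap_nonempty (hK : IsCompact K) (hne : K.Nonempty) (w : E) (hd : 0 ≤ d) :
    (cap K w d).Nonempty := by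
  obtain ⟨x, hx, hmin⟩ :=
    hK.exists_isMinOn hne (f := fun x => ⟪x, w⟫) (by fun_prop)
  exact ⟨x, hx, fun a ha => (hmin ha).trans (by simpa using hd)⟩

theorem inner_le_supportFunction (hA : IsCompact A) (hx : x ∈ A) (v : E) :
    ⟪x, v⟫ ≤ supportFunction A v :=
  le_csSup (hA.image (f := fun x => ⟪x, v⟫) (by fun_prop)).bddAbove (mem_image_of_mem _ hx)

theorem exists_inner_eq_supportFunction (hA : IsCompact A) (hne : A.Nonempty) (v : E) :
    ∃ x ∈ A, ⟪x, v⟫ = supportFunction A v :=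
  (hA.image (f := fun x => ⟪x, v⟫) (by fun_prop)).sSup_mem (hne.image _)

theorem width_nonneg (hA : IsCompact A) (hne : A.Nonempty) (v : E) : 0 ≤ width A v := by
  obtain ⟨x, hx⟩ := hne
  have h₁ := inner_le_supportFunction hA hx v
  have h₂ := inner_le_supportFunction hA hx (-v)
  rw [inner_neg_right] at h₂
  unfold width
  linarith

theorem width_neg (A : Set E) (v : E) : width A (-v) = width A v := by
  rw [width, width, neg_neg, add_comm]

theorem upperSemicontinuous_supportFunction {Y : Type*} [TopologicalSpace Y] (hK : IsCompact K)
    {A : Y → Set E} (hA : IsClosed {p : Y × E | p.2 ∈ A p.1}) (hsub : ∀ y, A y ⊆ K)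
    (hne : ∀ y, (A y).Nonempty) {v : Y → E} (hv : Continuous v) :
    UpperSemicontinuous fun y => supportFunction (A y) (v y) := by
  have hAc (y : Y) : IsCompact (A y) :=
    hK.of_isClosed_subset (hA.preimage (Continuous.prodMk_right y)) (hsub y)
  rw [upperSemicontinuous_iff_isClosed_preimage]
  intro c
  convert isClosed_setOf_exists_mem hK (hA.inter (isClosed_le
    (f := fun _ : Y × E => c) (g := fun p => ⟪p.2, v p.1⟫) (by fun_prop) (by fun_prop))) using 1
  ext y
  constructor
  · intro hy
    obtain ⟨x, hx, hxv⟩ := exists_inner_eq_supportFunction (hAc y) (hne y) (v y)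
    exact ⟨x, hsub y hx, hx, hy.trans_eq hxv.symm⟩
  · rintro ⟨x, -, hx, hcx⟩
    exact le_trans hcx (inner_le_supportFunction (hAc y) hx (v y))

theorem measurable_supportFunction_cap {Y : Type*} [TopologicalSpace Y] [MeasurableSpace Y]
    [OpensMeasurableSpace Y] (hK : IsCompact K) (hne : K.Nonempty) (hd : 0 ≤ d) {u v : Y → E}
    (hu : Continuous u) (hv : Continuous v) :
    Measurable fun y => supportFunction (cap K (u y) d) (v y) :=
  (upperSemicontinuous_supportFunction (A := fun y => cap K (u y) d) hK
    ((isClosed_setOf_mem_cap hK.isClosed d).preimage (hu.prodMap continuous_id))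
    (fun _ _ hx => hx.1) (fun y => cap_nonempty hK hne (u y) hd) hv).measurable

theorem supportSet_mono {D D' : Set E} (h : D ⊆ D') : supportSet K D ⊆ supportSet K D' :=
  fun _ ⟨w, hw, hx⟩ => ⟨w, h hw, hx⟩

theorem isCompact_supportSet (hK : IsCompact K) {D : Set E} (hD : IsCompact D) :
    IsCompact (supportSet K D) := by
  have hgraph : IsCompact (D ×ˢ K ∩ {p : E × E | p.2 ∈ cap K p.1 0}) :=
    (hD.prod hK).inter_right (isClosed_setOf_mem_cap hK.isClosed 0)
  convert hgraph.image continuous_snd using 1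
  ext x
  constructor
  · rintro ⟨w, hw, hx⟩
    exact ⟨(w, x), ⟨⟨hw, hx.1⟩, hx⟩, rfl⟩
  · rintro ⟨⟨w, y⟩, ⟨⟨hw, -⟩, hy⟩, rfl⟩
    exact ⟨w, hw, hy⟩

theorem isPreconnected_supportSet (hK : IsCompact K) (hKc : Convex ℝ K) (hne : K.Nonempty)
    {D : Set E} (hD : IsPreconnected D) : IsPreconnected (supportSet K D) := by
  rw [isPreconnected_closed_iff]
  rintro t t' ht ht' hcover ⟨x, ⟨w, hw, hx⟩, hxt⟩ ⟨x', ⟨w', hw', hx'⟩, hxt'⟩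
  have hclosed {s : Set E} (hs : IsClosed s) : IsClosed {w | (cap K w 0 ∩ s).Nonempty} := by
    convert isClosed_setOf_exists_mem hK
      ((isClosed_setOf_mem_cap hK.isClosed 0).inter (hs.preimage continuous_snd)) using 1
    ext w
    exact ⟨fun ⟨x, hx, hxs⟩ => ⟨x, hx.1, hx, hxs⟩, fun ⟨x, _, hx, hxs⟩ => ⟨x, hx, hxs⟩⟩
  obtain ⟨v, hv, ⟨y, hy, hyt⟩, ⟨y', hy', hyt'⟩⟩ :=
    isPreconnected_closed_iff.mp hD _ _ (hclosed ht) (hclosed ht')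
      (fun v hv => by
        obtain ⟨y, hy⟩ := cap_nonempty hK hne v le_rfl
        exact (hcover ⟨v, hv, hy⟩).imp (fun h => ⟨y, hy, h⟩) fun h => ⟨y, hy, h⟩)
      ⟨w, hw, x, hx, hxt⟩ ⟨w', hw', x', hx', hxt'⟩
  obtain ⟨z, hz, hztt'⟩ := isPreconnected_closed_iff.mp (convex_cap hKc v 0).isPreconnected t t'
    ht ht' (fun z hz => hcover ⟨v, hv, hz⟩) ⟨y, hy, hyt⟩ ⟨y', hy', hyt'⟩
  exact ⟨z, ⟨v, hv, hz⟩, hztt'⟩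

/-- The length by which `x` lies beyond the face of `K` with inner normal `w`, measured along `v`
from the point of this face where `⟪·, v⟫` is smallest. -/
noncomputable def faceOffset (K : Set E) (w v x : E) : ℝ :=
  ⟪x, v⟫ + supportFunction (cap K w 0) (-v)

/-- The largest offset, along `v`, of the points of the cap of depth `d` from the face. -/
noncomputable def capExtent (K : Set E) (w v : E) (d : ℝ) : ℝ :=
  supportFunction (cap K w d) v + supportFunction (cap K w 0) (-v)

theorem lipschitzWith_faceOffset (K : Set E) (w : E) (hv : ‖v‖ ≤ 1) :
    LipschitzWith 1 (faceOffset K w v) :=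
  LipschitzWith.of_le_add fun a b => by
    have : ⟪a - b, v⟫ ≤ dist a b := by
      rw [dist_eq_norm]
      exact (real_inner_le_norm _ _).trans (mul_le_of_le_one_right (norm_nonneg _) hv)
    rw [inner_sub_left] at this
    simp only [faceOffset]
    linarith

theorem exists_faceOffset_eq_inner (hK : IsCompact K) (hne : K.Nonempty) (w v : E) :
    ∃ y ∈ cap K w 0, ∀ x, faceOffset K w v x = ⟪x - y, v⟫ := by
  obtain ⟨y, hy, hyv⟩ :=
    exists_inner_eq_supportFunction (isCompact_cap hK w 0) (cap_nonempty hK hne w le_rfl) (-v)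
  exact ⟨y, hy, fun x => by
    rw [faceOffset, ← hyv, inner_neg_right, inner_sub_left, sub_eq_add_neg]⟩

theorem inner_sub_le_faceOffset (hK : IsCompact K) {y : E} (hy : y ∈ cap K w 0) (v x : E) :
    ⟪x - y, v⟫ ≤ faceOffset K w v x := by
  have := inner_le_supportFunction (isCompact_cap hK w 0) hy (-v)
  rw [inner_neg_right] at this
  rw [faceOffset, inner_sub_left]
  linarith

theorem exists_faceOffset_eq_capExtent (hK : IsCompact K) (hne : K.Nonempty) (w v : E)
    (hd : 0 ≤ d) : ∃ p ∈ cap K w d, faceOffset K w v p = capExtent K w v d := by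
  obtain ⟨p, hp, hpv⟩ :=
    exists_inner_eq_supportFunction (isCompact_cap hK w d) (cap_nonempty hK hne w hd) v
  exact ⟨p, hp, by rw [faceOffset, capExtent, hpv]⟩

theorem capExtent_nonneg (hK : IsCompact K) (hne : K.Nonempty) (w v : E) (hd : 0 ≤ d) :
    0 ≤ capExtent K w v d := by
  obtain ⟨y, hy⟩ := cap_nonempty hK hne w le_rfl
  have h₁ := inner_le_supportFunction (isCompact_cap hK w d) (cap_mono hd hy) v
  have h₂ := inner_le_supportFunction (isCompact_cap hK w 0) hy (-v)
  rw [inner_neg_right] at h₂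
  unfold capExtent
  linarith

theorem width_cap_le (hK : IsCompact K) (hne : K.Nonempty) (w v : E) (d : ℝ) :
    width (cap K w d) v ≤ capExtent K w v d + capExtent K w (-v) d := by
  have := width_nonneg (isCompact_cap hK w 0) (cap_nonempty hK hne w le_rfl) v
  simp only [width, capExtent, neg_neg] at this ⊢
  linarith

theorem ofReal_width_cap_sq_le (hK : IsCompact K) (hne : K.Nonempty) (w v : E) (hd : 0 ≤ d) :
    ENNReal.ofReal (width (cap K w d) v) ^ 2 ≤
      2 * (ENNReal.ofReal (capExtent K w v d) ^ 2 + ENNReal.ofReal (capExtent K w (-v) d) ^ 2) := by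
  have h₁ := capExtent_nonneg hK hne w v hd
  have h₂ := capExtent_nonneg hK hne w (-v) hd
  have h := width_nonneg (isCompact_cap hK w d) (cap_nonempty hK hne w hd) v
  rw [← ENNReal.ofReal_pow h, ← ENNReal.ofReal_pow h₁, ← ENNReal.ofReal_pow h₂,
    ← ENNReal.ofReal_add (sq_nonneg _) (sq_nonneg _), ← ENNReal.ofReal_ofNat 2,
    ← ENNReal.ofReal_mul zero_le_two]
  exact ENNReal.ofReal_le_ofReal
    ((pow_le_pow_left₀ h (width_cap_le hK hne w v d) 2).trans add_sq_le)

theorem measurable_capExtent {Y : Type*} [TopologicalSpace Y] [MeasurableSpace Y]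
    [OpensMeasurableSpace Y] (hK : IsCompact K) (hne : K.Nonempty) (hd : 0 ≤ d) {u v : Y → E}
    (hu : Continuous u) (hv : Continuous v) : Measurable fun y => capExtent K (u y) (v y) d :=
  (measurable_supportFunction_cap hK hne hd hu hv).add
    (measurable_supportFunction_cap hK hne le_rfl hu hv.neg)

end Caps

theorem mul_cos_le_sin {x : ℝ} (h₀ : 0 ≤ x) (h₁ : x < π / 2) : x * Real.cos x ≤ Real.sin x := by
  have hcos : 0 < Real.cos x := Real.cos_pos_of_mem_Ioo ⟨by linarith, h₁⟩
  have := Real.le_tan h₀ h₁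
  rwa [Real.tan_eq_sin_div_cos, le_div_iff₀ hcos] at this

section MovingFrame

variable {E : Type*} [NormedAddCommGroup E] [InnerProductSpace ℝ E]

/-- A pair of vectors rotating with unit speed, `U' = -V` and `V' = U` (stated in integrated form),
of which `V` has norm at most one. For a unit vector `U φ` in a Euclidean plane, taken as the inner
normal of a convex set, `V φ` is the direction in which the point of support moves as `φ`
increases. -/
structure IsMovingFrame (U V : ℝ → E) : Prop where
  left_add : ∀ φ κ, U (φ + κ) = Real.cos κ • U φ - Real.sin κ • V φ
  right_add : ∀ φ κ, V (φ + κ) = Real.sin κ • U φ + Real.cos κ • V φ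
  norm_right_le : ∀ φ, ‖V φ‖ ≤ 1

namespace IsMovingFrame

variable {U V : ℝ → E} {K : Set E} {φ φ' ψ d : ℝ} {x y y' p : E}

theorem continuous_left (hf : IsMovingFrame U V) : Continuous U := by
  have : U = fun κ => Real.cos κ • U 0 - Real.sin κ • V 0 := by
    funext κ
    simpa using hf.left_add 0 κ
  rw [this]
  fun_prop

theorem continuous_right (hf : IsMovingFrame U V) : Continuous V := by
  have : V = fun κ => Real.sin κ • U 0 + Real.cos κ • V 0 := by
    funext κ
    simpa using hf.right_add 0 κ
  rw [this]
  fun_prop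

theorem reverse (hf : IsMovingFrame U V) :
    IsMovingFrame (fun φ => U (-φ)) (fun φ => -V (-φ)) where
  left_add φ κ := by
    rw [neg_add, hf.left_add, Real.cos_neg, Real.sin_neg]
    module
  right_add φ κ := by
    rw [neg_add, hf.right_add, Real.cos_neg, Real.sin_neg]
    module
  norm_right_le φ := by simpa using hf.norm_right_le (-φ)

theorem inner_left (hf : IsMovingFrame U V) (z : E) (φ ψ : ℝ) :
    ⟪z, U ψ⟫ = Real.cos (ψ - φ) * ⟪z, U φ⟫ - Real.sin (ψ - φ) * ⟪z, V φ⟫ := by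
  rw [← real_inner_smul_right, ← real_inner_smul_right, ← inner_sub_right, ← hf.left_add,
    add_sub_cancel]

theorem inner_right (hf : IsMovingFrame U V) (z : E) (φ ψ : ℝ) :
    ⟪z, V ψ⟫ = Real.sin (ψ - φ) * ⟪z, U φ⟫ + Real.cos (ψ - φ) * ⟪z, V φ⟫ := by
  rw [← real_inner_smul_right, ← real_inner_smul_right, ← inner_add_right, ← hf.right_add,
    add_sub_cancel]

theorem inner_sub_nonneg (hf : IsMovingFrame U V) (hφ : φ < φ') (hφ' : φ' - φ < π / 2)
    (hy : y ∈ cap K (U φ) 0) (hy' : y' ∈ cap K (U φ') 0) : 0 ≤ ⟪y' - y, V φ⟫ := by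
  have hcos : 0 ≤ Real.cos (φ' - φ) := Real.cos_nonneg_of_mem_Icc ⟨by linarith, hφ'.le⟩
  have hsin : 0 < Real.sin (φ' - φ) := Real.sin_pos_of_pos_of_lt_pi (by linarith) (by linarith)
  have hU : 0 ≤ ⟪y' - y, U φ⟫ := by
    rw [inner_sub_left]
    exact sub_nonneg.mpr (inner_le_of_mem_face hy hy'.1)
  have hU' : ⟪y' - y, U φ'⟫ ≤ 0 := by
    rw [inner_sub_left]
    exact sub_nonpos.mpr (inner_le_of_mem_face hy' hy.1)
  rw [hf.inner_left _ φ] at hU'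
  exact nonneg_of_mul_nonneg_right (by nlinarith) hsin

theorem sub_mul_inner_le (hf : IsMovingFrame U V) (hd : 0 ≤ d) (hφ : φ ≤ ψ)
    (hψ : ψ - φ < π / 2) (hp : p ∈ cap K (U φ) d) (hx : x ∈ cap K (U ψ) 0) :
    (ψ - φ) * ⟪p - x, V φ⟫ ≤ d := by
  rcases le_total ⟪p - x, V φ⟫ 0 with hneg | hpos
  · exact (mul_nonpos_of_nonneg_of_nonpos (by linarith) hneg).trans hd
  have hcos : 0 < Real.cos (ψ - φ) := Real.cos_pos_of_mem_Ioo ⟨by linarith, hψ⟩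
  have hU : ⟪p - x, U φ⟫ ≤ d := by
    rw [inner_sub_left]
    linarith [hp.2 x hx.1]
  have hU' : 0 ≤ ⟪p - x, U ψ⟫ := by
    rw [inner_sub_left]
    exact sub_nonneg.mpr (inner_le_of_mem_face hx hp.1)
  rw [hf.inner_left _ φ] at hU'
  refine le_of_mul_le_mul_left ?_ hcos
  calc Real.cos (ψ - φ) * ((ψ - φ) * ⟪p - x, V φ⟫)
      = (ψ - φ) * Real.cos (ψ - φ) * ⟪p - x, V φ⟫ := by ring
    _ ≤ Real.sin (ψ - φ) * ⟪p - x, V φ⟫ := by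
        gcongr
        exact mul_cos_le_sin (by linarith) hψ
    _ ≤ Real.cos (ψ - φ) * ⟪p - x, U φ⟫ := by linarith
    _ ≤ Real.cos (ψ - φ) * d := by gcongr

theorem inner_sub_le_two_mul (hf : IsMovingFrame U V) (hφ : φ < φ') (hφ' : φ' ≤ ψ)
    (hψ : ψ - φ ≤ 1) (hx : x ∈ cap K (U ψ) 0) (hy : y ∈ cap K (U φ) 0)
    (hy' : y' ∈ cap K (U φ') 0) : ⟪x - y', V φ'⟫ ≤ 2 * ⟪x - y, V φ⟫ := by
  have hpi := Real.pi_gt_three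
  have hxy : 0 ≤ ⟪x - y, V φ⟫ := hf.inner_sub_nonneg (by linarith) (by linarith) hy hx
  rcases le_total ⟪x - y', V φ'⟫ 0 with hneg | hpos
  · linarith
  have hcos : 0 < Real.cos (ψ - φ') := Real.cos_pos_of_mem_Ioo ⟨by linarith, by linarith⟩
  have hsin : 0 ≤ Real.sin (φ' - φ) := Real.sin_nonneg_of_nonneg_of_le_pi (by linarith)
    (by linarith)
  have hhalf : 1 / 2 ≤ Real.cos (ψ - φ) := by
    nlinarith [Real.one_sub_sq_div_two_le_cos (x := ψ - φ)]
  have hU : Real.cos (ψ - φ') * ⟪x - y', U φ'⟫ ≤ Real.sin (ψ - φ') * ⟪x - y', V φ'⟫ := by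
    have : ⟪x - y', U ψ⟫ ≤ 0 := by
      rw [inner_sub_left]
      exact sub_nonpos.mpr (inner_le_of_mem_face hx hy'.1)
    rw [hf.inner_left _ φ'] at this
    linarith
  have hstep : ⟪x - y', V φ⟫ ≤ ⟪x - y, V φ⟫ := by
    have := hf.inner_sub_nonneg hφ (by linarith) hy hy'
    rw [inner_sub_left] at this ⊢
    rw [inner_sub_left]
    linarith
  have hrot := hf.inner_right (x - y') φ' φ
  rw [← neg_sub φ' φ, Real.sin_neg, Real.cos_neg] at hrot
  have key : Real.cos (ψ - φ) * ⟪x - y', V φ'⟫ ≤ ⟪x - y, V φ⟫ :=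
    calc Real.cos (ψ - φ) * ⟪x - y', V φ'⟫
        = Real.cos (ψ - φ') * (Real.cos (φ' - φ) * ⟪x - y', V φ'⟫)
          - Real.sin (φ' - φ) * (Real.sin (ψ - φ') * ⟪x - y', V φ'⟫) := by
          rw [show ψ - φ = (ψ - φ') + (φ' - φ) by ring, Real.cos_add]
          ring
      _ ≤ Real.cos (ψ - φ') * (Real.cos (φ' - φ) * ⟪x - y', V φ'⟫)
          - Real.sin (φ' - φ) * (Real.cos (ψ - φ') * ⟪x - y', U φ'⟫) := by gcongr
      _ = Real.cos (ψ - φ') * ⟪x - y', V φ⟫ := by rw [hrot]; ring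
      _ ≤ Real.cos (ψ - φ') * ⟪x - y, V φ⟫ := by gcongr
      _ ≤ ⟪x - y, V φ⟫ := mul_le_of_le_one_left hxy (Real.cos_le_one _)
  nlinarith

end IsMovingFrame

end MovingFrame

theorem setLIntegral_le_of_forall_mul_ediam_le {A : Set ℝ} {f : ℝ → ℝ≥0∞} {c : ℝ≥0∞}
    (h : ∀ t ∈ A, f t * ediam A ≤ c) : ∫⁻ t in A, f t ≤ c := by
  by_cases hvol : volume A = 0
  · rw [setLIntegral_measure_zero A f hvol]
    exact zero_le
  have hdiam : ediam A ≠ 0 := fun h0 => hvol (le_antisymm (h0 ▸ Real.volume_le_diam A) zero_le)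
  by_cases hc : c = ⊤
  · exact hc ▸ le_top
  calc ∫⁻ t in A, f t ≤ ∫⁻ _ in A, c / ediam A :=
        setLIntegral_mono measurable_const fun t ht =>
          (ENNReal.le_div_iff_mul_le (.inl hdiam) (.inr hc)).mpr (h t ht)
    _ = c / ediam A * volume A := setLIntegral_const A _
    _ ≤ c / ediam A * ediam A := by gcongr; exact Real.volume_le_diam A
    _ ≤ c := ENNReal.mul_le_of_le_div le_rfl

theorem lintegral_mul_measure_le {α X : Type*} [MeasurableSpace α] [MeasurableSpace X]
    {ν : Measure α} {μ : Measure X} [SFinite ν] [SFinite μ] {R : Set (α × X)}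
    (hR : MeasurableSet R) {f : α → ℝ≥0∞} (hf : Measurable f) {c : ℝ≥0∞}
    (h : ∀ᵐ x ∂μ, ∫⁻ t in (·, x) ⁻¹' R, f t ∂ν ≤ c) :
    ∫⁻ t, f t * μ (Prod.mk t ⁻¹' R) ∂ν ≤ c * μ univ := by
  have hmeas : Measurable (R.indicator fun p => f p.1) := (hf.comp measurable_fst).indicator hR
  calc ∫⁻ t, f t * μ (Prod.mk t ⁻¹' R) ∂ν
      = ∫⁻ t, ∫⁻ x, R.indicator (fun p => f p.1) (t, x) ∂μ ∂ν := by
        refine lintegral_congr fun t => ?_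
        rw [← lintegral_indicator_const (measurable_prodMk_left hR)]
        rfl
    _ = ∫⁻ x, ∫⁻ t, R.indicator (fun p => f p.1) (t, x) ∂ν ∂μ :=
        lintegral_lintegral_swap hmeas.aemeasurable
    _ = ∫⁻ x, ∫⁻ t in (·, x) ⁻¹' R, f t ∂ν ∂μ := by
        refine lintegral_congr fun x => ?_
        rw [← lintegral_indicator (measurable_prodMk_right hR)]
        rfl
    _ ≤ ∫⁻ _, c ∂μ := lintegral_mono_ae h
    _ = c * μ univ := lintegral_const c

section MiddleArcs

variable {E : Type*} [NormedAddCommGroup E] [InnerProductSpace ℝ E]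

/-- The points whose offset, along `V φ`, from the face with inner normal `U φ` lies between a
quarter and a half of the extent of the cap of depth `d`. -/
def middleStrip (K : Set E) (U V : ℝ → E) (d φ : ℝ) : Set E :=
  {x | faceOffset K (U φ) (V φ) x ∈
    Icc (capExtent K (U φ) (V φ) d / 4) (capExtent K (U φ) (V φ) d / 2)}

variable {U V : ℝ → E} {K : Set E} {α β κ φ φ' ψ d : ℝ} {x : E}

theorem ofReal_capExtent_le_hausdorffMeasure [MeasurableSpace E] [BorelSpace E]
    (hf : IsMovingFrame U V) (hK : IsCompact K) (hKc : Convex ℝ K) (hne : K.Nonempty)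
    (hd : 0 ≤ d) (hκ : 0 < κ) (hκ' : κ ≤ 1) (hS : 2 * d ≤ κ * capExtent K (U φ) (V φ) d) :
    ENNReal.ofReal (capExtent K (U φ) (V φ) d / 4) ≤
      μH[1] (supportSet K (U '' Icc φ (φ + κ)) ∩ middleStrip K U V d φ) := by
  set S := capExtent K (U φ) (V φ) d
  set offset := faceOffset K (U φ) (V φ)
  obtain ⟨y, hy, hyoff⟩ := exists_faceOffset_eq_inner hK hne (U φ) (V φ)
  obtain ⟨p, hp, hpS⟩ := exists_faceOffset_eq_capExtent hK hne (U φ) (V φ) hd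
  obtain ⟨z, hz⟩ := cap_nonempty hK hne (U (φ + κ)) le_rfl
  have hy0 : offset y = 0 := by simp [offset, hyoff]
  have hzS : S / 2 ≤ offset z := by
    have hsteep := hf.sub_mul_inner_le hd (by linarith)
      (by linarith [Real.pi_gt_three] : φ + κ - φ < π / 2) hp hz
    have hpz : ⟪p - z, V φ⟫ = capExtent K (U φ) (V φ) d - faceOffset K (U φ) (V φ) z := by
      rw [← hpS, hyoff, hyoff z, ← inner_sub_left, sub_sub_sub_cancel_right]
    rw [hpz, add_sub_cancel_left] at hsteep
    nlinarith
  have hlip : LipschitzWith 1 offset := lipschitzWith_faceOffset K _ (hf.norm_right_le φ)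
  have hS0 : 0 ≤ S := capExtent_nonneg hK hne _ _ hd
  have himage : Icc (S / 4) (S / 2) ⊆
      offset '' (supportSet K (U '' Icc φ (φ + κ)) ∩ middleStrip K U V d φ) := by
    intro s hs
    have hconn := isPreconnected_supportSet hK hKc hne
      ((isPreconnected_Icc (a := φ) (b := φ + κ)).image U hf.continuous_left.continuousOn)
    obtain ⟨x, hx, rfl⟩ := hconn.intermediate_value
      ⟨U φ, mem_image_of_mem U ⟨le_rfl, by linarith⟩, hy⟩
      ⟨U (φ + κ), mem_image_of_mem U ⟨by linarith, le_rfl⟩, hz⟩ hlip.continuous.continuousOn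
      ⟨by linarith [hs.1], hs.2.trans hzS⟩
    exact ⟨x, ⟨hx, hs⟩, rfl⟩
  calc ENNReal.ofReal (S / 4) = μH[1] (Icc (S / 4) (S / 2)) := by
        rw [hausdorffMeasure_real, Real.volume_Icc]
        ring_nf
    _ ≤ μH[1] (offset '' _) := measure_mono himage
    _ ≤ _ := by simpa using hlip.hausdorffMeasure_image_le zero_le_one _

theorem capExtent_mul_sub_le (hf : IsMovingFrame U V) (hK : IsCompact K) (hd : 0 ≤ d)
    (hx : x ∈ cap K (U ψ) 0) (hφ : φ ≤ ψ) (hψ : ψ - φ ≤ 1) (hxφ : x ∈ middleStrip K U V d φ) :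
    capExtent K (U φ) (V φ) d * (ψ - φ) ≤ 2 * d := by
  have hne : K.Nonempty := ⟨x, hx.1⟩
  obtain ⟨p, hp, hpS⟩ := exists_faceOffset_eq_capExtent hK hne (U φ) (V φ) hd
  have hsteep := hf.sub_mul_inner_le hd hφ (by linarith [Real.pi_gt_three]) hp hx
  have hpx : capExtent K (U φ) (V φ) d / 2 ≤ ⟪p - x, V φ⟫ := by
    have := hxφ.2
    rw [inner_sub_left]
    simp only [faceOffset] at hpS this
    linarith
  nlinarith

theorem capExtent_le_four_mul (hf : IsMovingFrame U V) (hK : IsCompact K)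
    (hx : x ∈ cap K (U ψ) 0) (hφ : φ ≤ φ') (hφ' : φ' ≤ ψ) (hψ : ψ - φ ≤ 1)
    (hxφ : x ∈ middleStrip K U V d φ) (hxφ' : x ∈ middleStrip K U V d φ') :
    capExtent K (U φ') (V φ') d ≤ 4 * capExtent K (U φ) (V φ) d := by
  have hne : K.Nonempty := ⟨x, hx.1⟩
  rcases hφ.eq_or_lt with rfl | hlt
  · linarith [hxφ.1.trans hxφ.2]
  obtain ⟨y', hy', hoff'⟩ := exists_faceOffset_eq_inner hK hne (U φ') (V φ')
  obtain ⟨y, hy⟩ := cap_nonempty hK hne (U φ) le_rfl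
  have hle : faceOffset K (U φ') (V φ') x ≤ 2 * faceOffset K (U φ) (V φ) x :=
    calc faceOffset K (U φ') (V φ') x = ⟪x - y', V φ'⟫ := hoff' x
      _ ≤ 2 * ⟪x - y, V φ⟫ := hf.inner_sub_le_two_mul hlt hφ' hψ hx hy hy'
      _ ≤ 2 * faceOffset K (U φ) (V φ) x := by
          gcongr
          exact inner_sub_le_faceOffset hK hy (V φ) x
  linarith [hxφ'.1, hxφ.2]

theorem le_of_mem_middleStrip (hf : IsMovingFrame U V) (hK : IsCompact K)
    (hx : x ∈ cap K (U ψ) 0) (hψ : φ - ψ < π / 2) (hS : 0 < capExtent K (U φ) (V φ) d)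
    (hxφ : x ∈ middleStrip K U V d φ) : φ ≤ ψ := by
  by_contra! hlt
  obtain ⟨y, hy, hoff⟩ := exists_faceOffset_eq_inner hK ⟨x, hx.1⟩ (U φ) (V φ)
  have hneg : 0 ≤ ⟪x - y, -V φ⟫ := by
    simpa using hf.reverse.inner_sub_nonneg (neg_lt_neg hlt) (by linarith)
      (by rwa [neg_neg]) (by rwa [neg_neg])
  have := hxφ.1
  rw [inner_neg_right, ← hoff] at hneg
  linarith

theorem setLIntegral_capExtent_middleStrip_le (hf : IsMovingFrame U V) (hK : IsCompact K)
    (hd : 0 < d) (hx : x ∈ supportSet K (U '' Icc α (α + 1))) {A : Set ℝ}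
    (hAI : A ⊆ Icc α (α + 1))
    (hpos : ∀ φ ∈ A, 0 < capExtent K (U φ) (V φ) d) (hxA : ∀ φ ∈ A, x ∈ middleStrip K U V d φ) :
    ∫⁻ φ in A, ENNReal.ofReal (capExtent K (U φ) (V φ) d) ≤ ENNReal.ofReal (8 * d) := by
  obtain ⟨-, ⟨ψ, hψ, rfl⟩, hx⟩ := hx
  have hle : ∀ φ ∈ A, φ ≤ ψ := fun φ hφ =>
    le_of_mem_middleStrip hf hK hx (by linarith [(hAI hφ).2, hψ.1, Real.pi_gt_three])
      (hpos φ hφ) (hxA φ hφ)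
  have hone : ∀ φ ∈ A, ψ - φ ≤ 1 := fun φ hφ => by linarith [(hAI hφ).1, hψ.2]
  have hdist : ∀ φ ∈ A, ∀ θ ∈ A, capExtent K (U φ) (V φ) d * (ψ - θ) ≤ 8 * d := by
    intro φ hφ θ hθ
    have hS := (hpos φ hφ).le
    rcases le_total θ φ with hθφ | hφθ
    · have := hle θ hθ
      calc capExtent K (U φ) (V φ) d * (ψ - θ)
          ≤ 4 * capExtent K (U θ) (V θ) d * (ψ - θ) := by
            gcongr
            exact capExtent_le_four_mul hf hK hx hθφ (hle φ hφ) (hone θ hθ) (hxA θ hθ) (hxA φ hφ)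
        _ ≤ 8 * d := by
            linarith [capExtent_mul_sub_le hf hK hd.le hx (hle θ hθ) (hone θ hθ) (hxA θ hθ)]
    · calc capExtent K (U φ) (V φ) d * (ψ - θ) ≤ capExtent K (U φ) (V φ) d * (ψ - φ) := by gcongr
        _ ≤ 2 * d := capExtent_mul_sub_le hf hK hd.le hx (hle φ hφ) (hone φ hφ) (hxA φ hφ)
        _ ≤ 8 * d := by linarith
  refine setLIntegral_le_of_forall_mul_ediam_le fun φ hφ => ?_
  have hS := hpos φ hφ
  have hsub : A ⊆ Icc (ψ - 8 * d / capExtent K (U φ) (V φ) d) ψ := fun θ hθ =>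
    ⟨by
      have := (le_div_iff₀' hS).mpr (hdist φ hφ θ hθ)
      linarith, hle θ hθ⟩
  calc ENNReal.ofReal (capExtent K (U φ) (V φ) d) * ediam A
      ≤ ENNReal.ofReal (capExtent K (U φ) (V φ) d) *
          ENNReal.ofReal (8 * d / capExtent K (U φ) (V φ) d) := by
        gcongr
        simpa using (ediam_mono hsub).trans_eq (Real.ediam_Icc _ _)
    _ = ENNReal.ofReal (8 * d) := by
        rw [← ENNReal.ofReal_mul hS.le, mul_div_cancel₀ _ hS.ne']

theorem measurableSet_setOf_mem_middleStrip [MeasurableSpace E] [BorelSpace E]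
    (hf : IsMovingFrame U V) (hK : IsCompact K) (hne : K.Nonempty) (hd : 0 ≤ d) :
    MeasurableSet {p : ℝ × E | p.2 ∈ middleStrip K U V d p.1} := by
  have hU := hf.continuous_left
  have hV := hf.continuous_right
  have hextent : Measurable fun p : ℝ × E => capExtent K (U p.1) (V p.1) d :=
    (measurable_capExtent hK hne hd hU hV).comp measurable_fst
  have hoffset : Measurable fun p : ℝ × E => faceOffset K (U p.1) (V p.1) p.2 :=
    Measurable.add (Continuous.measurable (by fun_prop))
      ((measurable_supportFunction_cap hK hne le_rfl hU hV.neg).comp measurable_fst)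
  exact (measurableSet_le (hextent.div_const 4) hoffset).inter
    (measurableSet_le hoffset (hextent.div_const 2))

theorem ofReal_capExtent_sq_le [MeasurableSpace E] [BorelSpace E]
    (hf : IsMovingFrame U V) (hK : IsCompact K) (hKc : Convex ℝ K) (hne : K.Nonempty)
    (hd : 0 ≤ d) (hκ : 0 < κ) (hβ : β + κ ≤ α + 1) (hφ : φ ∈ Icc α β)
    (hS : 2 * d ≤ κ * capExtent K (U φ) (V φ) d) :
    ENNReal.ofReal (capExtent K (U φ) (V φ) d) ^ 2 ≤
      4 * (ENNReal.ofReal (capExtent K (U φ) (V φ) d) *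
        μH[1] (middleStrip K U V d φ ∩ supportSet K (U '' Icc α (β + κ)))) := by
  have hS0 := capExtent_nonneg hK hne (U φ) (V φ) hd
  have hsub : supportSet K (U '' Icc φ (φ + κ)) ⊆ supportSet K (U '' Icc α (β + κ)) :=
    supportSet_mono (image_mono (Icc_subset_Icc hφ.1 (by linarith [hφ.2])))
  calc ENNReal.ofReal (capExtent K (U φ) (V φ) d) ^ 2
      = 4 * (ENNReal.ofReal (capExtent K (U φ) (V φ) d) *
          ENNReal.ofReal (capExtent K (U φ) (V φ) d / 4)) := by
        rw [← ENNReal.ofReal_mul hS0, ← ENNReal.ofReal_ofNat 4,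
          ← ENNReal.ofReal_mul (by norm_num), ← ENNReal.ofReal_pow hS0]
        ring_nf
    _ ≤ 4 * (ENNReal.ofReal (capExtent K (U φ) (V φ) d) *
          μH[1] (supportSet K (U '' Icc φ (φ + κ)) ∩ middleStrip K U V d φ)) := by
        gcongr
        exact ofReal_capExtent_le_hausdorffMeasure hf hK hKc hne hd hκ
          (by linarith [hφ.1, hφ.2]) hS
    _ ≤ _ := by
        rw [inter_comm]
        gcongr

theorem lintegral_capExtent_sq_le_of_large [MeasurableSpace E] [BorelSpace E]
    (hf : IsMovingFrame U V) (hK : IsCompact K) (hKc : Convex ℝ K) (hne : K.Nonempty)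
    (hd : 0 < d) (hκ : 0 < κ) (hβ : β + κ ≤ α + 1)
    (hfin : μH[1] (supportSet K (U '' Icc α (β + κ))) ≠ ⊤) :
    ∫⁻ φ in Icc α β ∩ {φ | 2 * d ≤ κ * capExtent K (U φ) (V φ) d},
        ENNReal.ofReal (capExtent K (U φ) (V φ) d) ^ 2 ≤
      ENNReal.ofReal (32 * d) * μH[1] (supportSet K (U '' Icc α (β + κ))) := by
  set S : ℝ → ℝ≥0∞ := fun φ => ENNReal.ofReal (capExtent K (U φ) (V φ) d)
  set T := Icc α β ∩ {φ | 2 * d ≤ κ * capExtent K (U φ) (V φ) d}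
  set Γ := supportSet K (U '' Icc α (β + κ))
  have hTpos : ∀ φ ∈ T, 0 < capExtent K (U φ) (V φ) d := fun φ hφ =>
    pos_of_mul_pos_right ((mul_pos two_pos hd).trans_le hφ.2) hκ.le
  have hTsub : T ⊆ Icc α (α + 1) := fun φ hφ => ⟨hφ.1.1, by linarith [hφ.1.2]⟩
  have hS : Measurable fun φ => capExtent K (U φ) (V φ) d :=
    measurable_capExtent hK hne hd.le hf.continuous_left hf.continuous_right
  have hTm : MeasurableSet T :=
    measurableSet_Icc.inter (measurableSet_le measurable_const (hS.const_mul κ))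
  have hΓm : MeasurableSet Γ :=
    (isCompact_supportSet hK (isCompact_Icc.image hf.continuous_left)).measurableSet
  have hR := measurableSet_setOf_mem_middleStrip hf hK hne hd.le
  have : IsFiniteMeasure (μH[1].restrict Γ) := ⟨by simpa using hfin.lt_top⟩
  have hcount : ∫⁻ φ in T, S φ * μH[1].restrict Γ (middleStrip K U V d φ) ≤
      ENNReal.ofReal (8 * d) * μH[1].restrict Γ univ := by
    refine lintegral_mul_measure_le hR hS.ennreal_ofReal ((ae_restrict_iff' hΓm).mpr (.of_forall
      fun x hx => ?_))
    rw [Measure.restrict_restrict (hR.preimage measurable_prodMk_right)]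
    exact setLIntegral_capExtent_middleStrip_le hf hK hd
      (supportSet_mono (image_mono (Icc_subset_Icc_right hβ)) hx)
      (fun φ hφ => hTsub hφ.2) (fun φ hφ => hTpos φ hφ.2) fun φ hφ => hφ.1
  calc ∫⁻ φ in T, S φ ^ 2
      ≤ ∫⁻ φ in T, 4 * (S φ * μH[1].restrict Γ (middleStrip K U V d φ)) := by
        refine setLIntegral_mono' hTm fun φ hφ => ?_
        rw [Measure.restrict_apply' hΓm]
        exact ofReal_capExtent_sq_le hf hK hKc hne hd.le hκ hβ hφ.1 hφ.2
    _ = 4 * ∫⁻ φ in T, S φ * μH[1].restrict Γ (middleStrip K U V d φ) :=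
        lintegral_const_mul' _ _ (by norm_num)
    _ ≤ 4 * (ENNReal.ofReal (8 * d) * μH[1].restrict Γ univ) := by gcongr
    _ = ENNReal.ofReal (32 * d) * μH[1] Γ := by
        rw [Measure.restrict_apply_univ, ← mul_assoc, ← ENNReal.ofReal_ofNat 4,
          ← ENNReal.ofReal_mul (by norm_num)]
        ring_nf

theorem lintegral_capExtent_sq_le [MeasurableSpace E] [BorelSpace E]
    (hf : IsMovingFrame U V) (hK : IsCompact K) (hKc : Convex ℝ K) (hne : K.Nonempty)
    (hd : 0 < d) (hκ : 0 < κ) (hβ : β + κ ≤ α + 1)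
    (hfin : μH[1] (supportSet K (U '' Icc α (β + κ))) ≠ ⊤) :
    ∫⁻ φ in Icc α β, ENNReal.ofReal (capExtent K (U φ) (V φ) d) ^ 2 ≤
      ENNReal.ofReal (32 * d) * μH[1] (supportSet K (U '' Icc α (β + κ))) +
        ENNReal.ofReal ((2 * d / κ) ^ 2) := by
  have hT : MeasurableSet {φ | 2 * d ≤ κ * capExtent K (U φ) (V φ) d} :=
    measurableSet_le measurable_const
      ((measurable_capExtent hK hne hd.le hf.continuous_left hf.continuous_right).const_mul κ)
  rw [← lintegral_inter_add_sdiff _ (Icc α β) hT]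
  refine add_le_add (lintegral_capExtent_sq_le_of_large hf hK hKc hne hd hκ hβ hfin) ?_
  calc ∫⁻ φ in Icc α β \ {φ | 2 * d ≤ κ * capExtent K (U φ) (V φ) d},
        ENNReal.ofReal (capExtent K (U φ) (V φ) d) ^ 2
      ≤ ∫⁻ _ in Icc α β \ {φ | 2 * d ≤ κ * capExtent K (U φ) (V φ) d},
          ENNReal.ofReal ((2 * d / κ) ^ 2) := by
        refine setLIntegral_mono' (measurableSet_Icc.diff hT) fun φ hφ => ?_
        have hsmall : capExtent K (U φ) (V φ) d ≤ 2 * d / κ :=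
          (le_div_iff₀' hκ).mpr (not_le.mp hφ.2).le
        rw [← ENNReal.ofReal_pow (capExtent_nonneg hK hne _ _ hd.le)]
        gcongr
        exact capExtent_nonneg hK hne _ _ hd.le
    _ ≤ ENNReal.ofReal ((2 * d / κ) ^ 2) * volume (Icc α β) := by
        rw [setLIntegral_const]
        gcongr
        exact sdiff_subset
    _ ≤ ENNReal.ofReal ((2 * d / κ) ^ 2) := by
        refine mul_le_of_le_one_right' ?_
        rw [Real.volume_Icc]
        exact ENNReal.ofReal_le_one.mpr (by linarith)

theorem setLIntegral_comp_neg_Icc (f : ℝ → ℝ≥0∞) (a b : ℝ) :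
    ∫⁻ t in Icc (-b) (-a), f (-t) = ∫⁻ t in Icc a b, f t := by
  have := (Measure.measurePreserving_neg (volume : Measure ℝ)).setLIntegral_comp_preimage_emb
    (Homeomorph.neg ℝ).measurableEmbedding f (Icc a b)
  rwa [neg_preimage, neg_Icc] at this

theorem lintegral_capExtent_neg_sq_le [MeasurableSpace E] [BorelSpace E]
    (hf : IsMovingFrame U V) (hK : IsCompact K) (hKc : Convex ℝ K) (hne : K.Nonempty)
    (hd : 0 < d) (hκ : 0 < κ) (hβ : β + κ ≤ α + 1)
    (hfin : μH[1] (supportSet K (U '' Icc (α - κ) β)) ≠ ⊤) :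
    ∫⁻ φ in Icc α β, ENNReal.ofReal (capExtent K (U φ) (-V φ) d) ^ 2 ≤
      ENNReal.ofReal (32 * d) * μH[1] (supportSet K (U '' Icc (α - κ) β)) +
        ENNReal.ofReal ((2 * d / κ) ^ 2) := by
  have himage : (fun φ => U (-φ)) '' Icc (-β) (-α + κ) = U '' Icc (α - κ) β := by
    rw [← image_image U, image_neg_eq_neg, neg_Icc, neg_neg, neg_add, neg_neg, sub_eq_add_neg]
  rw [← setLIntegral_comp_neg_Icc, ← himage]
  exact lintegral_capExtent_sq_le hf.reverse hK hKc hne hd hκ (by linarith) (himage ▸ hfin)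

theorem lintegral_width_cap_sq_le [MeasurableSpace E] [BorelSpace E]
    (hf : IsMovingFrame U V) (hK : IsCompact K) (hKc : Convex ℝ K) (hne : K.Nonempty)
    (hd : 0 < d) (hκ : 0 < κ) (hβ : β + κ ≤ α + 1)
    (hfin : μH[1] (supportSet K (U '' Icc (α - κ) (β + κ))) ≠ ⊤) :
    ∫⁻ φ in Icc α β, ENNReal.ofReal (width (cap K (U φ) d) (V φ)) ^ 2 ≤
      ENNReal.ofReal (128 * d) * μH[1] (supportSet K (U '' Icc (α - κ) (β + κ))) +
        ENNReal.ofReal (16 * (d / κ) ^ 2) := by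
  set Γ := supportSet K (U '' Icc (α - κ) (β + κ))
  have hright : supportSet K (U '' Icc α (β + κ)) ⊆ Γ :=
    supportSet_mono (image_mono (Icc_subset_Icc_left (by linarith)))
  have hleft : supportSet K (U '' Icc (α - κ) β) ⊆ Γ :=
    supportSet_mono (image_mono (Icc_subset_Icc_right (by linarith)))
  have hmeas : Measurable fun φ => ENNReal.ofReal (capExtent K (U φ) (V φ) d) ^ 2 :=
    ((measurable_capExtent hK hne hd.le hf.continuous_left
      hf.continuous_right).ennreal_ofReal).pow_const 2
  calc ∫⁻ φ in Icc α β, ENNReal.ofReal (width (cap K (U φ) d) (V φ)) ^ 2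
      ≤ ∫⁻ φ in Icc α β, 2 * (ENNReal.ofReal (capExtent K (U φ) (V φ) d) ^ 2 +
          ENNReal.ofReal (capExtent K (U φ) (-V φ) d) ^ 2) :=
        lintegral_mono fun φ => ofReal_width_cap_sq_le hK hne (U φ) (V φ) hd.le
    _ = 2 * ((∫⁻ φ in Icc α β, ENNReal.ofReal (capExtent K (U φ) (V φ) d) ^ 2) +
          ∫⁻ φ in Icc α β, ENNReal.ofReal (capExtent K (U φ) (-V φ) d) ^ 2) := by
        rw [lintegral_const_mul' _ _ (by norm_num), lintegral_add_left hmeas]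
    _ ≤ 2 * (ENNReal.ofReal (32 * d) * μH[1] Γ + ENNReal.ofReal ((2 * d / κ) ^ 2) +
          (ENNReal.ofReal (32 * d) * μH[1] Γ + ENNReal.ofReal ((2 * d / κ) ^ 2))) := by
        gcongr
        · refine (lintegral_capExtent_sq_le hf hK hKc hne hd hκ hβ
            (measure_ne_top_of_subset hright hfin)).trans ?_
          gcongr
        · refine (lintegral_capExtent_neg_sq_le hf hK hKc hne hd hκ hβ
            (measure_ne_top_of_subset hleft hfin)).trans ?_
          gcongr
    _ = ENNReal.ofReal (128 * d) * μH[1] Γ + ENNReal.ofReal (16 * (d / κ) ^ 2) := by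
        rw [show 128 * d = 4 * (32 * d) by ring,
          show 16 * (d / κ) ^ 2 = 4 * (2 * d / κ) ^ 2 by ring,
          ENNReal.ofReal_mul zero_le_four, ENNReal.ofReal_mul zero_le_four, ENNReal.ofReal_ofNat]
        ring

end MiddleArcs

section FiniteLength

variable {E : Type*} [NormedAddCommGroup E] [InnerProductSpace ℝ E]

theorem exists_norm_sub_smul_eq {R : ℝ} {x w : E} (hx : ‖x‖ ≤ R) (hw : w ≠ 0) :
    ∃ t : ℝ, 0 ≤ t ∧ ‖x - t • w‖ = R := by
  have hR : 0 ≤ R := (norm_nonneg x).trans hx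
  have hw' : 0 < ‖w‖ := norm_pos_iff.mpr hw
  have hfar : R ≤ ‖x - (2 * R / ‖w‖) • w‖ :=
    calc R ≤ ‖(2 * R / ‖w‖) • w‖ - ‖x‖ := by
          rw [norm_smul, Real.norm_of_nonneg (by positivity), div_mul_cancel₀ _ hw'.ne']
          linarith
      _ ≤ ‖x - (2 * R / ‖w‖) • w‖ := by
          rw [norm_sub_rev]
          exact norm_sub_norm_le _ _
  obtain ⟨t, ht, htR⟩ := intermediate_value_Icc (f := fun t : ℝ => ‖x - t • w‖)
    (by positivity : 0 ≤ 2 * R / ‖w‖) (by fun_prop) ⟨by simpa using hx, hfar⟩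
  exact ⟨t, ht.1, htR⟩

theorem norm_sub_le_norm_sub_smul_sub {K : Set E} {w w' x x' : E} {t t' : ℝ}
    (hx : x ∈ cap K w 0) (hx' : x' ∈ cap K w' 0) (ht : 0 ≤ t) (ht' : 0 ≤ t') :
    ‖x - x'‖ ≤ ‖(x - t • w) - (x' - t' • w')‖ := by
  have h : ⟪x - x', t • w - t' • w'⟫ ≤ 0 := by
    have h₁ := mul_le_mul_of_nonneg_left (inner_le_of_mem_face hx hx'.1) ht
    have h₂ := mul_le_mul_of_nonneg_left (inner_le_of_mem_face hx' hx.1) ht'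
    rw [inner_sub_right, inner_sub_left, inner_sub_left]
    simp only [real_inner_smul_right]
    linarith
  refine le_of_sq_le_sq ?_ (norm_nonneg _)
  rw [sub_sub_sub_comm, norm_sub_sq_real (x - x')]
  nlinarith [sq_nonneg ‖t • w - t' • w'‖]

-- Moving each point outwards along a normal until it reaches the sphere increases distances.
theorem hausdorffMeasure_supportSet_le_sphere [MeasurableSpace E] [BorelSpace E] {K D : Set E}
    {R r : ℝ} (hr : 0 ≤ r) (hK : K ⊆ closedBall 0 R) (hD : 0 ∉ D) :
    μH[r] (supportSet K D) ≤ μH[r] (sphere (0 : E) R) := by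
  have hout (x : supportSet K D) :
      ∃ w : E, ∃ t : ℝ, 0 ≤ t ∧ x.1 ∈ cap K w 0 ∧ ‖x.1 - t • w‖ = R := by
    obtain ⟨x, w, hw, hx⟩ := x
    obtain ⟨t, ht, htR⟩ := exists_norm_sub_smul_eq (mem_closedBall_zero_iff.mp (hK hx.1))
      (ne_of_mem_of_not_mem hw hD)
    exact ⟨w, t, ht, hx, htR⟩
  choose w t ht hw hR using hout
  have hanti : AntilipschitzWith 1 fun x : supportSet K D => x.1 - t x • w x :=
    AntilipschitzWith.of_le_mul_dist fun x x' => by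
      rw [NNReal.coe_one, one_mul, Subtype.dist_eq, dist_eq_norm, dist_eq_norm]
      exact norm_sub_le_norm_sub_smul_sub (hw x) (hw x') (ht x) (ht x')
  calc μH[r] (supportSet K D) = μH[r] (univ : Set (supportSet K D)) := by
        rw [← (isometry_subtype_coe (s := supportSet K D)).hausdorffMeasure_image (.inl hr),
          image_univ, Subtype.range_coe]
    _ ≤ μH[r] ((fun x : supportSet K D => x.1 - t x • w x) '' univ) := by
        simpa using hanti.le_hausdorffMeasure_image hr univ
    _ ≤ μH[r] (sphere (0 : E) R) := by
        refine measure_mono ?_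
        rintro _ ⟨x, -, rfl⟩
        exact mem_sphere_zero_iff_norm.mpr (hR x)

theorem biInter_supportSet_Icc {U : ℝ → E} (hU : Continuous U) {K : Set E} (hK : IsClosed K)
    (α β : ℝ) :
    ⋂ κ > (0 : ℝ), supportSet K (U '' Icc (α - κ) (β + κ)) = supportSet K (U '' Icc α β) := by
  refine Subset.antisymm (fun x hx => ?_) (subset_iInter₂ fun κ hκ => supportSet_mono
    (image_mono (Icc_subset_Icc (sub_le_self α hκ.le) (le_add_of_nonneg_right hκ.le))))
  let N (κ : Ioi (0 : ℝ)) : Set ℝ := Icc (α - κ) (β + κ) ∩ {ψ | x ∈ cap K (U ψ) 0}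
  have hN (κ) : IsCompact (N κ) := isCompact_Icc.inter_right
    ((isClosed_setOf_mem_cap hK 0).preimage (hU.prodMk continuous_const))
  have hdir : Directed (· ⊇ ·) N := directed_of_isDirected_ge fun κ κ' (h : κ.1 ≤ κ'.1) =>
    inter_subset_inter_left _ (Icc_subset_Icc (sub_le_sub_left h α) (by gcongr))
  have hne (κ) : (N κ).Nonempty := by
    obtain ⟨_, ⟨ψ, hψ, rfl⟩, hxψ⟩ := mem_iInter₂.mp hx κ κ.2
    exact ⟨ψ, hψ, hxψ⟩
  obtain ⟨ψ, hψ⟩ := IsCompact.nonempty_iInter_of_directed_nonempty_isCompact_isClosed N hdir hne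
    hN fun κ => (hN κ).isClosed
  rw [mem_iInter] at hψ
  refine ⟨U ψ, mem_image_of_mem U ⟨?_, ?_⟩, (hψ ⟨1, mem_Ioi.mpr one_pos⟩).2⟩
  · exact le_of_forall_pos_le_add fun ε hε => sub_le_iff_le_add.mp (hψ ⟨ε, hε⟩).1.1
  · exact le_of_forall_pos_le_add fun ε hε => (hψ ⟨ε, hε⟩).1.2

theorem tendsto_hausdorffMeasure_supportSet [MeasurableSpace E] [BorelSpace E] {U : ℝ → E}
    (hU : Continuous U) {K : Set E} (hK : IsCompact K) {r : ℝ}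
    (hfin : μH[r] (supportSet K (range U)) ≠ ⊤) (α β : ℝ) :
    Tendsto (fun κ => μH[r] (supportSet K (U '' Icc (α - κ) (β + κ)))) (𝓝[>] 0)
      (𝓝 (μH[r] (supportSet K (U '' Icc α β)))) := by
  rw [← biInter_supportSet_Icc hU hK.isClosed]
  refine tendsto_measure_biInter_gt (fun κ _ => ?_) (fun κ κ' _ h => ?_)
    ⟨1, one_pos, measure_ne_top_of_subset (supportSet_mono (image_subset_range U _)) hfin⟩
  · exact (isCompact_supportSet hK (isCompact_Icc.image hU)).measurableSet.nullMeasurableSet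
  · exact supportSet_mono (image_mono
      (Icc_subset_Icc (sub_le_sub_left h α) (add_le_add_right h β)))

end FiniteLength

section Plane

/-- The unit vector `u(θ - π/2) = (sin θ, -cos θ)`, orthogonal to `u(θ)`. -/
noncomputable def tangentVec (θ : ℝ) : EuclideanSpace ℝ (Fin 2) :=
  !₂[Real.sin θ, -Real.cos θ]

theorem inner_unitVec (θ φ : ℝ) : ⟪unitVec θ, unitVec φ⟫ = Real.cos (θ - φ) := by
  simp [unitVec, EuclideanSpace.inner_eq_star_dotProduct, Real.cos_sub, mul_comm]

theorem norm_unitVec (θ : ℝ) : ‖unitVec θ‖ = 1 := by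
  simp [unitVec, EuclideanSpace.norm_eq]

theorem norm_tangentVec (θ : ℝ) : ‖tangentVec θ‖ = 1 := by
  simp [tangentVec, EuclideanSpace.norm_eq]

theorem unitVec_add_pi (θ : ℝ) : unitVec (θ + π) = -unitVec θ := by
  ext i
  fin_cases i <;> simp [unitVec]

theorem tangentVec_add_pi (θ : ℝ) : tangentVec (θ + π) = -tangentVec θ := by
  ext i
  fin_cases i <;> simp [tangentVec]

theorem inner_unitVec_tangentVec (θ : ℝ) : ⟪unitVec θ, tangentVec θ⟫ = 0 := by
  simp [unitVec, tangentVec, EuclideanSpace.inner_eq_star_dotProduct, mul_comm]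

theorem exists_orthonormalBasis_unitVec (θ : ℝ) :
    ∃ b : OrthonormalBasis (Fin 2) ℝ (EuclideanSpace ℝ (Fin 2)),
      b 0 = unitVec θ ∧ b 1 = tangentVec θ := by
  have hon : Orthonormal ℝ ![unitVec θ, tangentVec θ] := by
    refine ⟨fun i => ?_, fun i j hij => ?_⟩
    · fin_cases i <;> simp [norm_unitVec, norm_tangentVec]
    · have h := inner_unitVec_tangentVec θ
      have h' := (real_inner_comm (unitVec θ) (tangentVec θ)).trans h
      fin_cases i <;> fin_cases j <;> simp_all
  have hspan := (hon.linearIndependent.span_eq_top_of_card_eq_finrank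
    (finrank_euclideanSpace (𝕜 := ℝ) (ι := Fin 2)).symm).ge
  exact ⟨OrthonormalBasis.mk hon hspan, by simp, by simp⟩

theorem isMovingFrame_unitVec : IsMovingFrame unitVec tangentVec where
  left_add φ κ := by
    ext i
    fin_cases i <;> simp [unitVec, tangentVec, Real.cos_add, Real.sin_add] <;> ring
  right_add φ κ := by
    ext i
    fin_cases i <;> simp [unitVec, tangentVec, Real.cos_add, Real.sin_add] <;> ring
  norm_right_le φ := (norm_tangentVec φ).le

theorem lipschitzWith_unitVec : LipschitzWith 1 unitVec :=
  LipschitzWith.of_dist_le_mul fun θ φ => by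
    rw [NNReal.coe_one, one_mul, dist_eq_norm, Real.dist_eq]
    refine le_of_sq_le_sq ?_ (abs_nonneg _)
    rw [norm_sub_sq_real, inner_unitVec, norm_unitVec, norm_unitVec, sq_abs]
    linarith [Real.one_sub_sq_div_two_le_cos (x := θ - φ)]

theorem exists_smul_unitVec (p : EuclideanSpace ℝ (Fin 2)) :
    ∃ θ ∈ Icc (-π) π, p = ‖p‖ • unitVec θ := by
  set z : ℂ := ⟨p 0, p 1⟩
  have hnorm : ‖z‖ = ‖p‖ := by
    simp [z, EuclideanSpace.norm_eq, Complex.norm_eq_sqrt_sq_add_sq]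
  refine ⟨z.arg, ⟨(Complex.neg_pi_lt_arg z).le, Complex.arg_le_pi z⟩, ?_⟩
  ext i
  fin_cases i
  · simp [unitVec, ← hnorm, z]
  · simp [unitVec, ← hnorm, z]

theorem hausdorffMeasure_sphere_ne_top (R : ℝ) :
    μH[1] (sphere (0 : EuclideanSpace ℝ (Fin 2)) R) ≠ ⊤ := by
  have hsub : sphere (0 : EuclideanSpace ℝ (Fin 2)) R ⊆
      (fun θ => R • unitVec θ) '' Icc (-π) π := by
    intro p hp
    obtain ⟨θ, hθ, hp'⟩ := exists_smul_unitVec p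
    exact ⟨θ, hθ, by simpa only [mem_sphere_zero_iff_norm.mp hp] using hp'.symm⟩
  refine measure_ne_top_of_subset hsub (ne_top_of_le_ne_top ?_
    (((lipschitzWith_smul R).comp lipschitzWith_unitVec).hausdorffMeasure_image_le zero_le_one _))
  rw [hausdorffMeasure_real, Real.volume_Icc]
  simp [ENNReal.mul_eq_top]

theorem hausdorffMeasure_supportSet_ne_top {K D : Set (EuclideanSpace ℝ (Fin 2))}
    (hK : Bornology.IsBounded K) (hD : 0 ∉ D) : μH[1] (supportSet K D) ≠ ⊤ := by
  obtain ⟨R, hR⟩ := hK.subset_closedBall 0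
  exact ne_top_of_le_ne_top (hausdorffMeasure_sphere_ne_top R)
    (hausdorffMeasure_supportSet_le_sphere zero_le_one hR hD)

end Plane

section HalfPeriod

variable {V F : Type*} [NormedAddCommGroup V] [InnerProductSpace ℝ V] [FiniteDimensional ℝ V]
  [MeasurableSpace V] [BorelSpace V] [NormedAddCommGroup F] [NormedSpace ℂ F]

theorem fourier_comp_add_right (f : V → F) (v w : V) :
    𝓕 (fun x => f (x + v)) w = 𝐞 ⟪v, w⟫ • 𝓕 f w :=
  congrFun (VectorFourier.fourierIntegral_comp_add_right 𝐞 volume (innerₗ V) f v) w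

theorem fourier_sub_comp_add_right {f : V → F} (hf : Integrable f) {v w : V}
    (h : 𝐞 ⟪v, w⟫ = -1) : 𝓕 (fun x => f x - f (x + v)) w = (2 : ℂ) • 𝓕 f w := by
  have hint {g : V → F} (hg : Integrable g) : Integrable fun x => 𝐞 (-⟪x, w⟫) • g x :=
    (Real.fourierIntegral_convergent_iff w).mpr hg
  have hadd := fourier_comp_add_right f v w
  rw [h, Real.fourier_eq] at hadd
  rw [Real.fourier_eq]
  simp_rw [smul_sub]
  rw [integral_sub (hint hf) (hint (hf.comp_add_right v)), hadd, ← Real.fourier_eq,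
    Circle.smul_def, Circle.coe_neg, Circle.coe_one, neg_one_smul, sub_neg_eq_add, two_smul]

theorem four_mul_norm_fourier_le {f : V → F} (hf : Integrable f) {v w : V}
    (h : ⟪v, w⟫ = 1 / 2) :
    4 * ‖𝓕 f w‖ ≤ ∫ x, ‖f x - f (x + v) - (f (x - v) - f x)‖ := by
  have hchar : 𝐞 ⟪v, w⟫ = -1 := by
    ext
    rw [h, Real.fourierChar_apply, Circle.coe_neg, Circle.coe_one, ← Complex.exp_pi_mul_I]
    push_cast
    ring_nf
  have hchar' : 𝐞 ⟪-v, w⟫ = -1 := by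
    rw [inner_neg_left, AddChar.map_neg_eq_inv, hchar, inv_neg_one]
  have hsecond := fourier_sub_comp_add_right (hf.sub (hf.comp_add_right v)) hchar'
  simp only [Pi.sub_apply, ← sub_eq_add_neg, sub_add_cancel] at hsecond
  have hfirst : 𝓕 (f - fun x => f (x + v)) w = (2 : ℂ) • 𝓕 f w :=
    fourier_sub_comp_add_right hf hchar
  have hnorm := VectorFourier.norm_fourierIntegral_le_integral_norm 𝐞 volume (innerₗ V)
    (fun x => f x - f (x + v) - (f (x - v) - f x)) w
  calc 4 * ‖𝓕 f w‖ = ‖𝓕 (fun x => f x - f (x + v) - (f (x - v) - f x)) w‖ := by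
        rw [hsecond, hfirst, smul_smul, norm_smul]
        norm_num
    _ ≤ _ := hnorm

end HalfPeriod

section ConcaveProfile

theorem integral_abs_le_two_mul_integral {X : Type*} [MeasurableSpace X] {μ : Measure X}
    {f N : X → ℝ} (hf : Integrable f μ) (hN : Integrable N μ) (hf₀ : ∫ x, f x ∂μ = 0)
    (hN₀ : 0 ≤ N) (hfN : -f ≤ N) : ∫ x, |f x| ∂μ ≤ 2 * ∫ x, N x ∂μ :=
  calc ∫ x, |f x| ∂μ ≤ ∫ x, (f x + 2 * N x) ∂μ := by
        refine integral_mono hf.abs (hf.add (hN.const_mul 2)) fun x => abs_le.mpr ⟨?_, ?_⟩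
        · linarith [hfN x, hN₀ x, Pi.neg_apply f x]
        · linarith [hN₀ x, Pi.zero_apply (M := fun _ => ℝ) x]
    _ = 2 * ∫ x, N x ∂μ := by
        rw [integral_add hf (hN.const_mul 2), hf₀, integral_const_mul, zero_add]

variable {g : ℝ → ℝ} {a b W W' : ℝ}

theorem add_sub_two_mul_le_indicator (hconc : ConcaveOn ℝ (Icc a b) g) (hg₀ : 0 ≤ g)
    (hsupp : ∀ t ∉ Icc a b, g t = 0) {η : ℝ} (hη : 0 ≤ η) (hW : ∀ t ≤ a + 2 * η, g t ≤ W)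
    (hW' : ∀ t, b - 2 * η ≤ t → g t ≤ W') (t : ℝ) :
    g (t + η) + g (t - η) - 2 * g t ≤
      (Icc (a - η) (a + η)).indicator (fun _ => W) t +
        (Icc (b - η) (b + η)).indicator (fun _ => W') t := by
  have hW₀ : 0 ≤ W := (hg₀ a).trans (hW a (by linarith))
  have hW₀' : 0 ≤ W' := (hg₀ b).trans (hW' b (by linarith))
  have hind : 0 ≤ (Icc (a - η) (a + η)).indicator (fun _ => W) t :=
    indicator_nonneg (fun _ _ => hW₀) t
  have hind' : 0 ≤ (Icc (b - η) (b + η)).indicator (fun _ => W') t :=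
    indicator_nonneg (fun _ _ => hW₀') t
  have hgt : 0 ≤ g t := hg₀ t
  rcases lt_or_ge t (a + η) with hta | hta
  · have hleft : g (t - η) = 0 := hsupp _ fun h => by linarith [h.1]
    by_cases hright : t + η ∈ Icc a b
    · rw [indicator_of_mem (mem_Icc.mpr ⟨by linarith [hright.1], hta.le⟩)]
      linarith [hW (t + η) (by linarith)]
    · linarith [hsupp _ hright]
  rcases lt_or_ge (b - η) t with htb | htb
  · have hright : g (t + η) = 0 := hsupp _ fun h => by linarith [h.2]
    by_cases hleft : t - η ∈ Icc a b
    · rw [indicator_of_mem (s := Icc (b - η) _) ⟨htb.le, by linarith [hleft.2]⟩]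
      linarith [hW' (t - η) (by linarith)]
    · linarith [hsupp _ hleft]
  · have hmid := hconc.2 (x := t + η) (y := t - η) ⟨by linarith, by linarith⟩
      ⟨by linarith, by linarith⟩ one_half_pos.le one_half_pos.le (add_halves 1)
    simp only [smul_eq_mul] at hmid
    rw [show 1 / 2 * (t + η) + 1 / 2 * (t - η) = t by ring] at hmid
    linarith

theorem integral_abs_secondDifference_le (hconc : ConcaveOn ℝ (Icc a b) g) (hg : Integrable g)
    (hg₀ : 0 ≤ g) (hsupp : ∀ t ∉ Icc a b, g t = 0) {η : ℝ} (hη : 0 ≤ η)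
    (hW : ∀ t ≤ a + 2 * η, g t ≤ W) (hW' : ∀ t, b - 2 * η ≤ t → g t ≤ W') :
    ∫ t, |g t - g (t + η) - (g (t - η) - g t)| ≤ 4 * η * (W + W') := by
  have hW₀ : 0 ≤ W := (hg₀ a).trans (hW a (by linarith))
  have hW₀' : 0 ≤ W' := (hg₀ b).trans (hW' b (by linarith))
  have hind (c M : ℝ) : Integrable ((Icc (c - η) (c + η)).indicator fun _ => M) :=
    (integrable_indicator_iff measurableSet_Icc).mpr (by simp)
  have hforward := hg.sub (hg.comp_add_right η)
  have hbackward := (hg.comp_sub_right η).sub hg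
  have hzero : ∫ t, (g t - g (t + η) - (g (t - η) - g t)) = 0 :=
    calc ∫ t, (g t - g (t + η) - (g (t - η) - g t))
        = ((∫ t, g t) - ∫ t, g (t + η)) - ((∫ t, g (t - η)) - ∫ t, g t) := by
          rw [← integral_sub hg (hg.comp_add_right η), ← integral_sub (hg.comp_sub_right η) hg]
          exact integral_sub hforward hbackward
      _ = 0 := by
          rw [integral_sub_right_eq_self, integral_add_right_eq_self, sub_self]
  calc ∫ t, |g t - g (t + η) - (g (t - η) - g t)|
      ≤ 2 * ∫ t, ((Icc (a - η) (a + η)).indicator (fun _ => W) t +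
          (Icc (b - η) (b + η)).indicator (fun _ => W') t) := by
        refine integral_abs_le_two_mul_integral (hforward.sub hbackward)
          ((hind a W).add (hind b W')) hzero (fun t => ?_) fun t => ?_
        · exact add_nonneg (indicator_nonneg (fun _ _ => hW₀) t)
            (indicator_nonneg (fun _ _ => hW₀') t)
        · refine le_trans (le_of_eq ?_)
            (add_sub_two_mul_le_indicator hconc hg₀ hsupp hη hW hW' t)
          simp only [Pi.neg_apply]
          ring
    _ = 4 * η * (W + W') := by
        rw [integral_add (hind a W) (hind b W'), integral_indicator_const _ measurableSet_Icc,
          integral_indicator_const _ measurableSet_Icc, Real.volume_real_Icc_of_le (by linarith),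
          Real.volume_real_Icc_of_le (by linarith), smul_eq_mul, smul_eq_mul]
        ring

theorem norm_fourier_le_of_concaveOn (hconc : ConcaveOn ℝ (Icc a b) g) (hg : Integrable g)
    (hg₀ : 0 ≤ g) (hsupp : ∀ t ∉ Icc a b, g t = 0) {ρ : ℝ} (hρ : 0 < ρ)
    (hW : ∀ t ≤ a + 1 / ρ, g t ≤ W) (hW' : ∀ t, b - 1 / ρ ≤ t → g t ≤ W') :
    ‖𝓕 (fun t => (g t : ℂ)) ρ‖ ≤ (W + W') / (2 * ρ) := by
  set η := 1 / (2 * ρ) with hη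
  have hηρ : 1 / ρ = 2 * η := by rw [hη]; field_simp
  have hinner : ⟪η, ρ⟫ = 1 / 2 := by
    rw [RCLike.inner_apply, conj_trivial, hη]
    field_simp
  have hgc : Integrable fun t => (g t : ℂ) := hg.ofReal
  have hfour := four_mul_norm_fourier_le hgc hinner
  simp only [← Complex.ofReal_sub, Complex.norm_real, Real.norm_eq_abs] at hfour
  rw [hηρ] at hW hW'
  have hΔ := integral_abs_secondDifference_le hconc hg hg₀ hsupp
    (show 0 ≤ η by positivity) hW hW'
  calc ‖𝓕 (fun t => (g t : ℂ)) ρ‖ ≤ η * (W + W') := by linarith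
    _ = (W + W') / (2 * ρ) := by rw [hη, one_div_mul_eq_div]

end ConcaveProfile

section Chords

variable {E : Type*} [NormedAddCommGroup E] [InnerProductSpace ℝ E]
  {b : OrthonormalBasis (Fin 2) ℝ E} {K : Set E}

/-- The intersection of `K` with the line `{x | ⟪x, b 0⟫ = t}`, parametrised by the coordinate
along `b 1`. -/
def chord (b : OrthonormalBasis (Fin 2) ℝ E) (K : Set E) (t : ℝ) : Set ℝ :=
  {s | t • b 0 + s • b 1 ∈ K}

theorem inner_add_smul_zero (b : OrthonormalBasis (Fin 2) ℝ E) (t s : ℝ) :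
    ⟪t • b 0 + s • b 1, b 0⟫ = t := by
  simp [inner_add_left, real_inner_smul_left, b.inner_eq_ite]

theorem inner_add_smul_one (b : OrthonormalBasis (Fin 2) ℝ E) (t s : ℝ) :
    ⟪t • b 0 + s • b 1, b 1⟫ = s := by
  simp [inner_add_left, real_inner_smul_left, b.inner_eq_ite]

theorem inner_mem_chord {x : E} (hx : x ∈ K) : ⟪x, b 1⟫ ∈ chord b K ⟪x, b 0⟫ := by
  have := b.sum_repr' x
  rw [Fin.sum_univ_two, real_inner_comm, real_inner_comm x] at this
  rwa [chord, mem_ofPred_eq, this]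

theorem isCompact_chord (hK : IsCompact K) (t : ℝ) : IsCompact (chord b K t) :=
  (hK.image (f := fun x => ⟪x, b 1⟫) (by fun_prop)).of_isClosed_subset
    (hK.isClosed.preimage (f := fun s : ℝ => t • b 0 + s • b 1) (by fun_prop))
    fun s hs => ⟨_, hs, inner_add_smul_one b t s⟩

theorem chord_nonempty_iff {t : ℝ} : (chord b K t).Nonempty ↔ t ∈ (fun x => ⟪x, b 0⟫) '' K := by
  constructor
  · rintro ⟨s, hs⟩
    exact ⟨_, hs, inner_add_smul_zero b t s⟩
  · rintro ⟨x, hx, rfl⟩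
    exact ⟨_, inner_mem_chord hx⟩

theorem combo_mem_chord (hK : Convex ℝ K) {t t' s s' r r' : ℝ} (hs : s ∈ chord b K t)
    (hs' : s' ∈ chord b K t') (hr : 0 ≤ r) (hr' : 0 ≤ r') (h : r + r' = 1) :
    r * s + r' * s' ∈ chord b K (r * t + r' * t') := by
  convert hK hs hs' hr hr' h using 1
  simp only [chord, mem_ofPred_eq]
  congr! 1
  module

theorem convex_chord (hK : Convex ℝ K) (t : ℝ) : Convex ℝ (chord b K t) := by
  intro s hs s' hs' r r' hr hr' h
  simpa only [← add_mul, h, one_mul, smul_eq_mul] using combo_mem_chord hK hs hs' hr hr' h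

theorem mul_volume_add_mul_volume_le {A B C : Set ℝ} (hA : IsCompact A) (hA' : A.Nonempty)
    (hB : IsCompact B) (hB' : B.Nonempty) (hC : IsCompact C) (hC' : C.OrdConnected) {r r' : ℝ}
    (hr : 0 ≤ r) (hr' : 0 ≤ r') (h : ∀ s ∈ A, ∀ s' ∈ B, r * s + r' * s' ∈ C) :
    r * volume.real A + r' * volume.real B ≤ volume.real C := by
  have hle {s : Set ℝ} (hs : IsCompact s) : volume.real s ≤ sSup s - sInf s := by
    rw [← Real.diam_eq hs.isBounded]
    exact ENNReal.toReal_mono hs.isBounded.ediam_ne_top (Real.volume_le_diam s)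
  have hinf := h _ (hA.sInf_mem hA') _ (hB.sInf_mem hB')
  have hsup := h _ (hA.sSup_mem hA') _ (hB.sSup_mem hB')
  calc r * volume.real A + r' * volume.real B
      ≤ r * (sSup A - sInf A) + r' * (sSup B - sInf B) := by
        gcongr
        · exact hle hA
        · exact hle hB
    _ = (r * sSup A + r' * sSup B) - (r * sInf A + r' * sInf B) := by ring
    _ ≤ volume.real (Icc (r * sInf A + r' * sInf B) (r * sSup A + r' * sSup B)) := by
        rw [Real.volume_real_Icc]
        exact le_max_left _ _
    _ ≤ volume.real C := measureReal_mono (hC'.out hinf hsup) hC.measure_lt_top.ne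

theorem concaveOn_volume_chord (hK : IsCompact K) (hKc : Convex ℝ K) :
    ConcaveOn ℝ ((fun x => ⟪x, b 0⟫) '' K) fun t => volume.real (chord b K t) := by
  refine ⟨hKc.is_linear_image ⟨fun _ _ => inner_add_left _ _ _,
    fun _ _ => real_inner_smul_left _ _ _⟩, fun t ht t' ht' r r' hr hr' h => ?_⟩
  exact mul_volume_add_mul_volume_le (isCompact_chord hK t) (chord_nonempty_iff.mpr ht)
    (isCompact_chord hK t') (chord_nonempty_iff.mpr ht') (isCompact_chord hK _)
    (convex_chord hKc _).ordConnected hr hr'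
    fun s hs s' hs' => combo_mem_chord hKc hs hs' hr hr' h

theorem chord_subset_chord_cap {t d : ℝ} (h : ∀ x ∈ K, t ≤ ⟪x, b 0⟫ + d) :
    chord b K t ⊆ chord b (cap K (b 0) d) t :=
  fun s hs => ⟨hs, fun x hx => by simpa only [inner_add_smul_zero] using h x hx⟩

theorem chord_subset_chord_cap_neg {t d : ℝ} (h : ∀ x ∈ K, ⟪x, b 0⟫ - d ≤ t) :
    chord b K t ⊆ chord b (cap K (-b 0) d) t :=
  fun s hs => ⟨hs, fun x hx => by
    simp only [inner_neg_right, inner_add_smul_zero]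
    linarith [h x hx]⟩

theorem volume_chord_le_width (hK : IsCompact K) (hne : K.Nonempty) (t : ℝ) :
    volume.real (chord b K t) ≤ width K (b 1) := by
  refine ENNReal.toReal_le_of_le_ofReal (width_nonneg hK hne _) ((Real.volume_le_diam _).trans
    (Metric.ediam_le fun s hs s' hs' => ?_))
  have hdist {s s' : ℝ} (hs : s ∈ chord b K t) (hs' : s' ∈ chord b K t) :
      s - s' ≤ width K (b 1) := by
    have h₁ := inner_le_supportFunction hK hs (b 1)
    have h₂ := inner_le_supportFunction hK hs' (-b 1)
    rw [inner_neg_right] at h₂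
    rw [inner_add_smul_one] at h₁ h₂
    rw [width]
    linarith
  rw [edist_dist, Real.dist_eq]
  exact ENNReal.ofReal_le_ofReal (abs_le.mpr ⟨by linarith [hdist hs' hs], hdist hs hs'⟩)

theorem integral_indicator_smul_add_smul {G : Type*} [NormedAddCommGroup G] [NormedSpace ℝ G]
    [CompleteSpace G] (hK : IsCompact K) (c : G) (t : ℝ) :
    ∫ s : ℝ, K.indicator (fun _ => c) (t • b 0 + s • b 1) = volume.real (chord b K t) • c :=
  integral_indicator_const c (isCompact_chord hK t).measurableSet

theorem measurableEmbedding_smul_add_smul [MeasurableSpace E] [BorelSpace E]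
    (b : OrthonormalBasis (Fin 2) ℝ E) :
    MeasurableEmbedding fun q : ℝ × ℝ => q.1 • b 0 + q.2 • b 1 := by
  refine Continuous.measurableEmbedding (by fun_prop) fun q q' h => Prod.ext ?_ ?_
  · simpa only [inner_add_smul_zero] using congrArg (fun x => ⟪x, b 0⟫) h
  · simpa only [inner_add_smul_one] using congrArg (fun x => ⟪x, b 1⟫) h

variable [FiniteDimensional ℝ E] [MeasurableSpace E] [BorelSpace E]

theorem measurePreserving_smul_add_smul (b : OrthonormalBasis (Fin 2) ℝ E) :
    MeasurePreserving fun q : ℝ × ℝ => q.1 • b 0 + q.2 • b 1 := by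
  have hφ : (fun q : ℝ × ℝ => q.1 • b 0 + q.2 • b 1) =
      b.repr.symm ∘ WithLp.toLp 2 ∘ MeasurableEquiv.finTwoArrow.symm := by
    ext q
    simp only [Function.comp_apply, ← b.sum_repr_symm, Fin.sum_univ_two]
    rfl
  rw [hφ]
  exact b.measurePreserving_repr_symm.comp
    ((PiLp.volume_preserving_toLp (Fin 2)).comp (volume_preserving_finTwoArrow ℝ).symm)

theorem fourier_smul_basis_zero {F : Type*} [NormedAddCommGroup F] [NormedSpace ℂ F]
    (b : OrthonormalBasis (Fin 2) ℝ E) {f : E → F} (hf : Integrable f) (ρ : ℝ) :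
    𝓕 f (ρ • b 0) = 𝓕 (fun t : ℝ => ∫ s : ℝ, f (t • b 0 + s • b 1)) ρ := by
  have hmp := measurePreserving_smul_add_smul b
  have hemb := measurableEmbedding_smul_add_smul b
  have hint : Integrable (fun q : ℝ × ℝ =>
      𝐞 (-⟪q.1 • b 0 + q.2 • b 1, ρ • b 0⟫) • f (q.1 • b 0 + q.2 • b 1))
      (volume.prod volume) := (hmp.integrable_comp_emb hemb).mpr
    ((Real.fourierIntegral_convergent_iff (ρ • b 0)).mpr hf)
  rw [Real.fourier_eq, Real.fourier_eq, ← hmp.integral_comp hemb, Measure.volume_eq_prod,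
    integral_prod _ hint]
  refine integral_congr_ae (ae_of_all _ fun t => ?_)
  simp only [real_inner_smul_right, inner_add_smul_zero, Circle.smul_def]
  rw [integral_smul, RCLike.inner_apply, conj_trivial]

theorem integrable_indicator_of_isCompact {G : Type*} [NormedAddCommGroup G] (hK : IsCompact K)
    (c : G) : Integrable (K.indicator fun _ => c) :=
  (integrable_indicator_iff hK.measurableSet).mpr (integrableOn_const hK.measure_ne_top)

theorem integrable_volume_chord (hK : IsCompact K) :
    Integrable fun t => volume.real (chord b K t) := by
  have hint : Integrable (fun q : ℝ × ℝ => K.indicator (fun _ => (1 : ℝ)) (q.1 • b 0 + q.2 • b 1))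
      (volume.prod volume) :=
    ((measurePreserving_smul_add_smul b).integrable_comp_emb
      (measurableEmbedding_smul_add_smul b)).mpr (integrable_indicator_of_isCompact hK 1)
  simpa only [integral_indicator_smul_add_smul hK, smul_eq_mul, mul_one]
    using hint.integral_prod_left

theorem fourier_indicator_smul_basis_zero (hK : IsCompact K) (ρ : ℝ) :
    𝓕 (K.indicator fun _ => (1 : ℂ)) (ρ • b 0) =
      𝓕 (fun t => (volume.real (chord b K t) : ℂ)) ρ := by
  rw [fourier_smul_basis_zero b (integrable_indicator_of_isCompact hK 1)]
  simp_rw [integral_indicator_smul_add_smul hK, Complex.real_smul, mul_one]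

theorem norm_fourier_indicator_le (hK : IsCompact K) (hKc : Convex ℝ K) (hne : K.Nonempty)
    {ρ : ℝ} (hρ : 0 < ρ) :
    ‖𝓕 (K.indicator fun _ => (1 : ℂ)) (ρ • b 0)‖ ≤
      (width (cap K (b 0) (1 / ρ)) (b 1) + width (cap K (-b 0) (1 / ρ)) (b 1)) / (2 * ρ) := by
  have hd : 0 ≤ 1 / ρ := by positivity
  have hconc := concaveOn_volume_chord (b := b) hK hKc
  set S := (fun x => ⟪x, b 0⟫) '' K
  have hS : IsCompact S := hK.image (by fun_prop)
  have hSIcc : S = Icc (sInf S) (sSup S) := eq_Icc_of_connected_compact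
    ⟨hne.image _, hKc.isPreconnected.image _ (by fun_prop)⟩ hS
  have hle {A : Set E} (hA : IsCompact A) (hA' : A.Nonempty) {t : ℝ}
      (h : chord b K t ⊆ chord b A t) : volume.real (chord b K t) ≤ width A (b 1) :=
    (measureReal_mono h (isCompact_chord hA t).measure_ne_top).trans
      (volume_chord_le_width hA hA' t)
  rw [fourier_indicator_smul_basis_zero hK]
  refine norm_fourier_le_of_concaveOn (hSIcc ▸ hconc) (integrable_volume_chord hK)
    (fun _ => measureReal_nonneg) (fun t ht => ?_) hρ
    (fun t ht => hle (isCompact_cap hK _ _) (cap_nonempty hK hne _ hd)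
      (chord_subset_chord_cap fun x hx => ?_))
    (fun t ht => hle (isCompact_cap hK _ _) (cap_nonempty hK hne _ hd)
      (chord_subset_chord_cap_neg fun x hx => ?_))
  · rw [← hSIcc, ← chord_nonempty_iff, not_nonempty_iff_eq_empty] at ht
    rw [ht, measureReal_empty]
  · linarith [csInf_le hS.bddBelow (mem_image_of_mem _ hx)]
  · linarith [le_csSup hS.bddAbove (mem_image_of_mem _ hx)]

end Chords

section SphericalAverage

variable {K C : Set (EuclideanSpace ℝ (Fin 2))} {α β ρ κ ε : ℝ}

theorem norm_indicatorFourier_le (hK : IsCompact K) (hKc : Convex ℝ K) (hne : K.Nonempty)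
    (hρ : 0 < ρ) (θ : ℝ) :
    ‖indicatorFourier K (ρ • unitVec θ)‖ ≤
      (width (cap K (unitVec θ) (1 / ρ)) (tangentVec θ) +
        width (cap K (unitVec (θ + π)) (1 / ρ)) (tangentVec (θ + π))) / (2 * ρ) := by
  obtain ⟨b, hb₀, hb₁⟩ := exists_orthonormalBasis_unitVec θ
  rw [unitVec_add_pi, tangentVec_add_pi, width_neg, ← hb₀, ← hb₁]
  exact norm_fourier_indicator_le hK hKc hne hρ

theorem sq_enorm_indicatorFourier_le (hK : IsCompact K) (hKc : Convex ℝ K) (hne : K.Nonempty)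
    (hρ : 0 < ρ) (θ : ℝ) :
    ‖indicatorFourier K (ρ • unitVec θ)‖ₑ ^ 2 ≤ ENNReal.ofReal ((1 / ρ) ^ 2 / 2) *
      (ENNReal.ofReal (width (cap K (unitVec θ) (1 / ρ)) (tangentVec θ)) ^ 2 +
        ENNReal.ofReal (width (cap K (unitVec (θ + π)) (1 / ρ)) (tangentVec (θ + π))) ^ 2) := by
  have hwidth φ : 0 ≤ width (cap K (unitVec φ) (1 / ρ)) (tangentVec φ) :=
    width_nonneg (isCompact_cap hK _ _) (cap_nonempty hK hne _ (by positivity)) _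
  have hle := norm_indicatorFourier_le hK hKc hne hρ θ
  set W := width (cap K (unitVec θ) (1 / ρ)) (tangentVec θ)
  set W' := width (cap K (unitVec (θ + π)) (1 / ρ)) (tangentVec (θ + π))
  rw [← ofReal_norm, ← ENNReal.ofReal_pow (norm_nonneg _), ← ENNReal.ofReal_pow (hwidth _),
    ← ENNReal.ofReal_pow (hwidth _), ← ENNReal.ofReal_add (by positivity) (by positivity),
    ← ENNReal.ofReal_mul (by positivity)]
  refine ENNReal.ofReal_le_ofReal ?_
  calc ‖indicatorFourier K (ρ • unitVec θ)‖ ^ 2 ≤ ((W + W') / (2 * ρ)) ^ 2 := by gcongr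
    _ = (1 / ρ) ^ 2 / 4 * (W + W') ^ 2 := by ring
    _ ≤ (1 / ρ) ^ 2 / 4 * (2 * (W ^ 2 + W' ^ 2)) := by gcongr; exact add_sq_le
    _ = (1 / ρ) ^ 2 / 2 * (W ^ 2 + W' ^ 2) := by ring

theorem setLIntegral_Icc_comp_add_right (f : ℝ → ℝ≥0∞) (α β t : ℝ) :
    ∫⁻ θ in Icc α β, f (θ + t) = ∫⁻ φ in Icc (α + t) (β + t), f φ := by
  simpa using (measurePreserving_add_right volume t).setLIntegral_comp_preimage_emb
    (measurableEmbedding_addRight t) f (Icc (α + t) (β + t))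

theorem measurable_width_cap_unitVec (hK : IsCompact K) (hne : K.Nonempty) {d : ℝ} (hd : 0 ≤ d) :
    Measurable fun φ => width (cap K (unitVec φ) d) (tangentVec φ) :=
  (measurable_supportFunction_cap hK hne hd isMovingFrame_unitVec.continuous_left
    isMovingFrame_unitVec.continuous_right).add
    (measurable_supportFunction_cap hK hne hd isMovingFrame_unitVec.continuous_left
      isMovingFrame_unitVec.continuous_right.neg)

theorem hausdorffMeasure_supportSet_unitVec_ne_top (hK : Bornology.IsBounded K)
    {D : Set (EuclideanSpace ℝ (Fin 2))} (hD : D ⊆ range unitVec) :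
    μH[1] (supportSet K D) ≠ ⊤ := by
  refine hausdorffMeasure_supportSet_ne_top hK fun h0 => ?_
  obtain ⟨θ, hθ⟩ := hD h0
  simpa [hθ] using norm_unitVec θ

theorem lintegral_width_cap_add_pi_sq_le (hK : IsCompact K) (hKc : Convex ℝ K) (hne : K.Nonempty)
    {d : ℝ} (hd : 0 < d) (hκ : 0 < κ) (hβ : β + κ ≤ α + 1) :
    ∫⁻ θ in Icc α β, (ENNReal.ofReal (width (cap K (unitVec θ) d) (tangentVec θ)) ^ 2 +
        ENNReal.ofReal (width (cap K (unitVec (θ + π)) d) (tangentVec (θ + π))) ^ 2) ≤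
      ENNReal.ofReal (128 * d) * (μH[1] (supportSet K (unitVec '' Icc (α - κ) (β + κ))) +
        μH[1] (supportSet K (unitVec '' Icc (α + π - κ) (β + π + κ)))) +
      ENNReal.ofReal (32 * (d / κ) ^ 2) := by
  set m := μH[1] (supportSet K (unitVec '' Icc (α - κ) (β + κ)))
  set m' := μH[1] (supportSet K (unitVec '' Icc (α + π - κ) (β + π + κ)))
  let W (φ : ℝ) : ℝ≥0∞ := ENNReal.ofReal (width (cap K (unitVec φ) d) (tangentVec φ)) ^ 2
  have hWm : Measurable W := (measurable_width_cap_unitVec hK hne hd.le).ennreal_ofReal.pow_const 2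
  have hW {a b : ℝ} (hab : b + κ ≤ a + 1) :=
    lintegral_width_cap_sq_le isMovingFrame_unitVec hK hKc hne hd hκ hab
      (hausdorffMeasure_supportSet_unitVec_ne_top hK.isBounded (image_subset_range _ _))
  calc ∫⁻ θ in Icc α β, (W θ + W (θ + π))
      = (∫⁻ θ in Icc α β, W θ) + ∫⁻ φ in Icc (α + π) (β + π), W φ := by
        rw [lintegral_add_left hWm, setLIntegral_Icc_comp_add_right]
    _ ≤ (ENNReal.ofReal (128 * d) * m + ENNReal.ofReal (16 * (d / κ) ^ 2)) +
          (ENNReal.ofReal (128 * d) * m' + ENNReal.ofReal (16 * (d / κ) ^ 2)) :=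
        add_le_add (hW hβ) (hW (by linarith))
    _ = ENNReal.ofReal (128 * d) * (m + m') + ENNReal.ofReal (32 * (d / κ) ^ 2) := by
        rw [add_add_add_comm, ← mul_add, ← ENNReal.ofReal_add (by positivity) (by positivity)]
        ring_nf

theorem lintegral_sq_enorm_indicatorFourier_le (hK : IsCompact K) (hKc : Convex ℝ K)
    (hne : K.Nonempty) (hρ : 0 < ρ) (hκ : 0 < κ) (hβ : β + κ ≤ α + 1) :
    ∫⁻ θ in Icc α β, ‖indicatorFourier K (ρ • unitVec θ)‖ₑ ^ 2 ≤
      ENNReal.ofReal ((1 / ρ) ^ 3) *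
        (64 * (μH[1] (supportSet K (unitVec '' Icc (α - κ) (β + κ))) +
          μH[1] (supportSet K (unitVec '' Icc (α + π - κ) (β + π + κ)))) +
        ENNReal.ofReal (16 / κ ^ 2 * (1 / ρ))) := by
  have hd : 0 < 1 / ρ := by positivity
  refine (lintegral_mono fun θ => sq_enorm_indicatorFourier_le hK hKc hne hρ θ).trans ?_
  rw [lintegral_const_mul' _ _ ENNReal.ofReal_ne_top]
  refine (mul_le_mul_right (lintegral_width_cap_add_pi_sq_le hK hKc hne hd hκ hβ) _).trans_eq ?_
  rw [← ENNReal.ofReal_ofNat 64, mul_add (ENNReal.ofReal ((1 / ρ) ^ 2 / 2)),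
    mul_add (ENNReal.ofReal ((1 / ρ) ^ 3)), ← mul_assoc, ← mul_assoc,
    ← ENNReal.ofReal_mul (by positivity), ← ENNReal.ofReal_mul (by positivity),
    ← ENNReal.ofReal_mul (by positivity), ← ENNReal.ofReal_mul (by positivity)]
  ring_nf

theorem eventually_lintegral_sq_enorm_indicatorFourier_le (hK : IsCompact K) (hKc : Convex ℝ K)
    (hne : K.Nonempty) (hβ : β < α + 1) (hε : 0 < ε) :
    ∀ᶠ ρ in atTop, ∫⁻ θ in Icc α β, ‖indicatorFourier K (ρ • unitVec θ)‖ₑ ^ 2 ≤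
      ENNReal.ofReal ((1 / ρ) ^ 3) * (64 * (μH[1] (supportSet K (unitVec '' Icc α β)) +
        μH[1] (supportSet K (unitVec '' Icc (α + π) (β + π)))) + ENNReal.ofReal ε) := by
  have hfin {D} (hD : D ⊆ range unitVec) : μH[1] (supportSet K D) ≠ ⊤ :=
    hausdorffMeasure_supportSet_unitVec_ne_top hK.isBounded hD
  have hlim (α β : ℝ) := tendsto_hausdorffMeasure_supportSet isMovingFrame_unitVec.continuous_left
    hK (hfin Subset.rfl) α β
  have hclose := (ENNReal.Tendsto.const_mul (a := 64) ((hlim α β).add (hlim (α + π) (β + π)))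
    (.inr (by norm_num))).eventually_lt_const (ENNReal.lt_add_right (b := ENNReal.ofReal (ε / 2))
    (by simp [ENNReal.mul_eq_top, hfin (image_subset_range _ _)]) (by simpa using hε))
  obtain ⟨κ, hκle, hκ0, hκ1⟩ := (hclose.and (Ioo_mem_nhdsGT (sub_pos.mpr hβ))).exists
  have hρlim : Tendsto (fun ρ : ℝ => 16 / κ ^ 2 * (1 / ρ)) atTop (𝓝 0) := by
    simpa using (tendsto_inv_atTop_zero (𝕜 := ℝ)).const_mul (16 / κ ^ 2)
  filter_upwards [eventually_gt_atTop 0, hρlim.eventually_le_const (half_pos hε)] with ρ hρ hle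
  refine (lintegral_sq_enorm_indicatorFourier_le hK hKc hne hρ hκ0 (by linarith)).trans ?_
  refine mul_le_mul_right ?_ _
  calc _ ≤ _ := add_le_add hκle.le (ENNReal.ofReal_le_ofReal hle)
    _ = _ := by
      rw [add_assoc, ← ENNReal.ofReal_add (by positivity) (by positivity), add_halves]

theorem setLIntegral_Icc_le_mul_of_forall_lt {f : ℝ → ℝ≥0∞} {α L : ℝ} {B : ℝ≥0∞} {n : ℕ}
    (h : ∀ j < n, ∫⁻ θ in Icc (α + j * L) (α + j * L + L), f θ ≤ B) :
    ∫⁻ θ in Icc α (α + n * L), f θ ≤ n * B := by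
  induction n with
  | zero => simp
  | succ n ih =>
    have hsub : Icc α (α + (n + 1 : ℕ) * L) ⊆
        Icc α (α + n * L) ∪ Icc (α + n * L) (α + n * L + L) := by
      rw [show α + ((n + 1 : ℕ) : ℝ) * L = α + n * L + L by push_cast; ring]
      exact Icc_subset_Icc_union_Icc
    calc ∫⁻ θ in Icc α (α + (n + 1 : ℕ) * L), f θ
        ≤ ∫⁻ θ in Icc α (α + n * L) ∪ Icc (α + n * L) (α + n * L + L), f θ :=
          lintegral_mono_set hsub
      _ ≤ (∫⁻ θ in Icc α (α + n * L), f θ) +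
            ∫⁻ θ in Icc (α + n * L) (α + n * L + L), f θ := lintegral_union_le _ _ _
      _ ≤ n * B + B :=
          add_le_add (ih fun j hj => h j (hj.trans n.lt_succ_self)) (h n n.lt_succ_self)
      _ = (n + 1 : ℕ) * B := by push_cast; ring

theorem indicatorFourier_closure (hC : Convex ℝ C) :
    indicatorFourier (closure C) = indicatorFourier C := by
  have hae : closure C =ᵐ[volume] C :=
    closure_ae_eq_of_null_frontier (hC.addHaar_frontier volume)
  funext w
  rw [indicatorFourier, indicatorFourier, Real.fourier_eq', Real.fourier_eq']
  refine integral_congr_ae ?_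
  filter_upwards [indicator_ae_eq_of_ae_eq_set (f := fun _ => (1 : ℂ)) hae] with x hx
  rw [hx]

theorem setOf_frontier_normalAngles_eq (C : Set (EuclideanSpace ℝ (Fin 2))) (I : Set ℝ) :
    {x | x ∈ frontier C ∧ (normalAngles C x ∩ I).Nonempty} =
      supportSet (closure C) (unitVec '' I) := by
  have hlb (r : ℝ) (w : EuclideanSpace ℝ (Fin 2)) (h : ∀ a ∈ C, r ≤ ⟪a, w⟫) :
      ∀ a ∈ closure C, r ≤ ⟪a, w⟫ :=
    closure_minimal (t := {a | r ≤ ⟪a, w⟫}) h (isClosed_le (by fun_prop) (by fun_prop))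
  ext x
  constructor
  · rintro ⟨hx, θ, hθ, hI⟩
    refine ⟨_, mem_image_of_mem _ hI, frontier_subset_closure hx, ?_⟩
    simpa using hlb _ _ fun a ha => hθ.1 (mem_image_of_mem _ ha)
  · rintro ⟨_, ⟨θ, hI, rfl⟩, hx⟩
    refine ⟨⟨hx.1, fun hint => ?_⟩, θ, ⟨?_, fun r hr => ?_⟩, hI⟩
    · exact notMem_interior_of_mem_face (norm_ne_zero_iff.mp (by simp [norm_unitVec])) hx
        (interior_mono subset_closure hint)
    · rintro _ ⟨a, ha, rfl⟩
      exact inner_le_of_mem_face hx (subset_closure ha)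
    · exact hlb r _ (fun a ha => hr (mem_image_of_mem _ ha)) x hx.1

theorem eventually_lintegral_sq_enorm_indicatorFourier_le_mul
    (hK : IsCompact K) (hKc : Convex ℝ K) (hne : K.Nonempty) (hαβ : α ≤ β) {n : ℕ}
    (hn : β < α + n) (hε : 0 < ε) :
    ∀ᶠ ρ in atTop, ∫⁻ θ in Icc α β, ‖indicatorFourier K (ρ • unitVec θ)‖ₑ ^ 2 ≤
      n * (ENNReal.ofReal ((1 / ρ) ^ 3) * (64 * (μH[1] (supportSet K (unitVec '' Icc α β)) +
        μH[1] (supportSet K (unitVec '' Icc (α + π) (β + π)))) + ENNReal.ofReal ε)) := by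
  have hn0 : 0 < (n : ℝ) := by linarith
  obtain ⟨L, hL⟩ : ∃ L, β = α + n * L := ⟨(β - α) / n, by field_simp; ring⟩
  have hL0 : 0 ≤ L := by nlinarith
  have hL1 : L < 1 := by nlinarith
  have hpieces := (Finset.range n).eventually_all.2 fun j _ =>
    eventually_lintegral_sq_enorm_indicatorFourier_le hK hKc hne (α := α + j * L)
      (β := α + j * L + L) (by linarith) hε
  filter_upwards [hpieces] with ρ hρ
  rw [hL]
  refine setLIntegral_Icc_le_mul_of_forall_lt fun j hj => ?_
  have hjn : (j : ℝ) + 1 ≤ n := by exact_mod_cast hj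
  have hj0 : α ≤ α + j * L := le_add_of_nonneg_right (by positivity)
  have hj1 : α + j * L + L ≤ α + n * L := by nlinarith
  refine (hρ j (Finset.mem_range.2 hj)).trans ?_
  gcongr _ * (64 * (μH[1] ?_ + μH[1] ?_) + _)
  · exact supportSet_mono (image_mono (Icc_subset_Icc hj0 hj1))
  · exact supportSet_mono (image_mono (Icc_subset_Icc (by linarith) (by linarith)))

theorem ofReal_perimeterPortion (hC : Bornology.IsBounded C) (I : Set ℝ) :
    ENNReal.ofReal (perimeterPortion C I) = μH[1] (supportSet (closure C) (unitVec '' I)) := by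
  rw [perimeterPortion, setOf_frontier_normalAngles_eq, measureReal_def, ENNReal.ofReal_toReal]
  exact hausdorffMeasure_supportSet_unitVec_ne_top hC.closure (image_subset_range _ I)

theorem eventually_sphericalAverage_le (hC : IsPlanarConvexBody C) (hαβ : α ≤ β) {n : ℕ}
    (hn : β < α + n) (hε : 0 < ε) :
    ∀ᶠ ρ in atTop, sphericalAverage C (Icc α β) ρ ≤ n * ((1 / ρ) ^ 3 *
      (64 * (perimeterPortion C (Icc α β) + perimeterPortion C (Icc (α + π) (β + π))) + ε)) := by
  have hne : (closure C).Nonempty := (hC.interior_nonempty.mono interior_subset).closure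
  have hP (I) : 0 ≤ perimeterPortion C I := measureReal_nonneg
  filter_upwards [eventually_lintegral_sq_enorm_indicatorFourier_le_mul
    hC.bounded.isCompact_closure hC.convex.closure hne hαβ hn hε, eventually_gt_atTop 0]
    with ρ hle hρ
  have hP₁ := hP (Icc α β)
  have hP₂ := hP (Icc (α + π) (β + π))
  rw [indicatorFourier_closure hC.convex, ← ofReal_perimeterPortion hC.bounded,
    ← ofReal_perimeterPortion hC.bounded] at hle
  refine (Real.le_norm_self _).trans ((norm_integral_le_lintegral_norm _).trans
    (ENNReal.toReal_le_of_le_ofReal (by positivity) ?_))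
  simp only [norm_pow, norm_norm, ENNReal.ofReal_pow (norm_nonneg _), ofReal_norm]
  refine hle.trans_eq ?_
  rw [ENNReal.ofReal_mul (by positivity), ENNReal.ofReal_mul (by positivity),
    ENNReal.ofReal_add (by positivity) hε.le, ENNReal.ofReal_mul (by norm_num),
    ENNReal.ofReal_add hP₁ hP₂, ENNReal.ofReal_natCast, ENNReal.ofReal_ofNat]

theorem asympLeWith_of_eventually_le_mul {c : ℝ} {f g : ℝ → ℝ} (hg : ∀ᶠ x in atTop, 0 < g x)
    (hle : ∀ᶠ x in atTop, f x ≤ c * g x) : AsympLeWith c f g := by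
  refine limsup_le_of_le (by isBoundedDefault) ?_
  filter_upwards [hg, hle] with x hgx hx
  exact EReal.coe_le_coe_iff.mpr ((div_le_iff₀ hgx).mpr hx)

theorem tendsto_pow_mul_zero_of_eventually_le {n : ℕ} {c : ℝ} {f : ℝ → ℝ} (hc : 0 < c)
    (hf : ∀ x, 0 ≤ f x) (hle : ∀ ε > 0, ∀ᶠ x in atTop, f x ≤ c * ((1 / x) ^ n * ε)) :
    Tendsto (fun x => x ^ n * f x) atTop (𝓝 0) := by
  rw [Metric.tendsto_nhds]
  intro ε hε
  filter_upwards [hle (ε / (2 * c)) (by positivity), eventually_gt_atTop 0] with x hx hx0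
  have := hf x
  rw [Real.dist_eq, sub_zero, abs_of_nonneg (by positivity)]
  calc x ^ n * f x ≤ x ^ n * (c * ((1 / x) ^ n * (ε / (2 * c)))) := by gcongr
    _ = ε / 2 := by rw [one_div_pow]; field_simp
    _ < ε := half_lt_self hε

end SphericalAverage

theorem lemma3p4 :
    ∃ c : ℝ, 0 < c ∧
      ∀ C : Set (EuclideanSpace ℝ (Fin 2)), IsPlanarConvexBody C →
      ∀ α β : ℝ, α ≤ β → β ≤ α + 2 * Real.pi →
        (0 < perimeterPortion C (Set.Icc α β)
              + perimeterPortion C (Set.Icc (α + Real.pi) (β + Real.pi)) →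
          AsympLeWith c (fun ρ => sphericalAverage C (Set.Icc α β) ρ)
            (fun ρ => ρ ^ (-3 : ℤ) * (perimeterPortion C (Set.Icc α β)
              + perimeterPortion C (Set.Icc (α + Real.pi) (β + Real.pi))))) ∧
        (perimeterPortion C (Set.Icc α β)
              + perimeterPortion C (Set.Icc (α + Real.pi) (β + Real.pi)) = 0 →
          Tendsto (fun ρ : ℝ => ρ ^ 3 * sphericalAverage C (Set.Icc α β) ρ) atTop (nhds 0)) := by
  refine ⟨455, by norm_num, fun C hC α β hαβ hβ => ?_⟩
  have hle {ε : ℝ} (hε : 0 < ε) :=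
    eventually_sphericalAverage_le hC hαβ (n := 7) (by push_cast; linarith [Real.pi_lt_d2]) hε
  refine ⟨fun hP => asympLeWith_of_eventually_le_mul ?_ ?_, fun hP => ?_⟩
  · filter_upwards [eventually_gt_atTop 0] with ρ hρ
    positivity
  · filter_upwards [hle hP] with ρ hρ
    refine hρ.trans_eq ?_
    rw [zpow_neg, one_div, inv_pow]
    norm_cast
    ring
  · refine tendsto_pow_mul_zero_of_eventually_le (c := 7) (by norm_num)
      (fun ρ => integral_nonneg fun θ => by positivity) fun ε hε => ?_
    simpa [hP] using hle hε
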